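/- Let $d\ge 2$, $K\ge 1$ and let $G$ be the nearest-neighbour graph on $V=\mathbb{Z}^{d-1}\times\{0,1,\dots,K\}$ (vertices are adjacent iff their $\ell^1$-distance is $1$). Consider the following zero-temperature Glauber dynamics $(\sigma'_x(t))_{x\in V,\,t\ge 0}$ with spins in $\{-1,+1\}$. All vertices of the bottom layer $\mathbb{Z}^{d-1}\times\{0\}$ are frozen to $+1$ for all time. The initial spins of the other vertices are i.i.d., equal to $+1$ with probability $\theta$ and to $-1$ with probability $1-\theta$. The vertices carry independent rate-$1$ Poisson clocks, and each clock ring carries an independent fair coin toss with values $\pm1$; initial spins, clocks and coins are independent. The spin of a non-frozen vertex $x$ changes only when the clock at $x$ rings; if it rings at time $t$, the sign of $$\Delta\mathcal{H}_x=2\sum_{y:\,y\sim x}\sigma'_x(t-)\,\sigma'_y(t-)$$ determines the update: if $\Delta\mathcal{H}_x<0$ the spin at $x$ is flipped, if $\Delta\mathcal{H}_x>0$ it is kept, and if $\Delta\mathcal{H}_x=0$ it is set to the value of the coin of that ring. Then for every $\theta\in(0,1]$, with probability $1$, a spin evolution following these rules exists, and every such evolution fixates to $+1$ consensus: for every $x\in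 V$ there is $T<\infty$ such that $\sigma'_x(t)=+1$ for all $t\ge T$. -/

import Mathlib

open MeasureTheory ProbabilityTheory Filter Topology
open scoped NNReal ENNReal

/-- Vertices of the slab `ℤ^(d-1) × {0, 1, …, K}`; the second component is the layer. -/
abbrev SlabVertex (d K : ℕ) : Type := (Fin (d - 1) → ℤ) × Fin (K + 1)

/-- The nearest-neighbour graph on `ℤ^(d-1) × {0, 1, …, K}` (free boundary conditions at the top
layer): two vertices are adjacent iff their `ℓ¹` distance is `1`. -/
def slabGraph (d K : ℕ) : SimpleGraph (SlabVertex d K) where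
  Adj x y := (∑ i, |x.1 i - y.1 i|) + |((x.2 : ℕ) : ℤ) - ((y.2 : ℕ) : ℤ)| = 1
  symm := ⟨fun x y h => by simpa only [abs_sub_comm] using h⟩
  loopless := ⟨fun x h => by simp at h⟩

theorem slabGraph_neighborSet_finite (d K : ℕ) (x : SlabVertex d K) :
    ((slabGraph d K).neighborSet x).Finite := by
  refine Set.Finite.subset
    ((Set.finite_Icc (x.1 - 1) (x.1 + 1)).prod (Set.finite_univ (α := Fin (K + 1)))) ?_
  intro y hy
  have hy' : (∑ i, |x.1 i - y.1 i|) + |((x.2 : ℕ) : ℤ) - ((y.2 : ℕ) : ℤ)| = 1 := hy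
  have key : ∀ i, |x.1 i - y.1 i| ≤ 1 := by
    intro i
    have h1 := Finset.single_le_sum (f := fun i => |x.1 i - y.1 i|)
      (fun j _ => abs_nonneg _) (Finset.mem_univ i)
    have h2 := abs_nonneg (((x.2 : ℕ) : ℤ) - ((y.2 : ℕ) : ℤ))
    linarith
  refine ⟨⟨fun i => ?_, fun i => ?_⟩, Set.mem_univ _⟩
  · have h := abs_le.mp (key i)
    simp only [Pi.sub_apply, Pi.one_apply]
    linarith
  · have h := abs_le.mp (key i)
    simp only [Pi.add_apply, Pi.one_apply]
    linarith

noncomputable instance slabGraph_locallyFinite (d K : ℕ) : (slabGraph d K).LocallyFinite :=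
  fun x => (slabGraph_neighborSet_finite d K x).fintype

/-- The bottom layer `ℤ^(d-1) × {0}`. -/
def slabBottom (d K : ℕ) : Set (SlabVertex d K) := {x | x.2 = 0}

/-- The change of the energy `-∑ σ_x σ_y` (sum over nearest-neighbour pairs) caused by a flip of
the spin at `x`. Spins are elements of `ℤˣ = {1, -1}`. -/
noncomputable def energyChange {V : Type*} (G : SimpleGraph V) [G.LocallyFinite]
    (σ : V → ℤˣ) (x : V) : ℤ :=
  2 * ∑ y ∈ G.neighborFinset x, (σ x : ℤ) * (σ y : ℤ)

/-- The new spin of the vertex `x` when its clock rings in the configuration `σ`: flip if this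
lowers the energy, keep the spin if a flip raises the energy, and in case of a tie take the
outcome `coin` of the coin toss. -/
noncomputable def updatedSpin {V : Type*} (G : SimpleGraph V) [G.LocallyFinite]
    (σ : V → ℤˣ) (x : V) (coin : ℤˣ) : ℤˣ :=
  if energyChange G σ x < 0 then -σ x
  else if 0 < energyChange G σ x then σ x
  else coin

/-- `IsTrajectory G F η N c σ`: the path `t ↦ σ t` is a realization of the zero-temperature
dynamics on `G`, with the vertices of `F` frozen to `+1` and initial spins `η` elsewhere, driven by
the clocks `N` and the coins `c`. Here `N x t` is the number of rings of the clock at `x` during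
`(0, t]`, so that the clock rings at `t > 0` iff `N x` jumps at `t`, and this ring is associated to
the coin toss `c x (N x t)`. -/
structure IsTrajectory {V : Type*} (G : SimpleGraph V) [G.LocallyFinite] (F : Set V)
    (η : V → ℤˣ) (N : V → ℝ≥0 → ℕ) (c : V → ℕ → ℤˣ) (σ : ℝ≥0 → V → ℤˣ) : Prop where
  /-- Frozen vertices have spin `+1` at all times. -/
  frozen : ∀ x ∈ F, ∀ t, σ t x = 1
  /-- The other vertices start from `η`. -/
  initial : ∀ x ∉ F, σ 0 x = η x
  /-- A spin does not change while its clock does not ring. -/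
  constant : ∀ x ∉ F, ∀ s t, s ≤ t → N x s = N x t → σ t x = σ s x
  /-- When the clock at `x` rings at time `t`, the spin at `x` is updated according to the
  configuration just before time `t`. -/
  update : ∀ x ∉ F, ∀ t, 0 < t → (∀ s < t, N x s < N x t) →
    ∀ᶠ s in 𝓝[<] t, σ t x = updatedSpin G (σ s) x (c x (N x t))

/-- `N` is the counting process of a Poisson process of rate `r`: almost surely it starts at `0`
and its paths are nondecreasing and right-continuous, its increments are independent, and
`N t - N s` has the Poisson distribution of parameter `r * (t - s)`. -/
structure IsPoissonProcess {Ω : Type*} [MeasurableSpace Ω] (N : ℝ≥0 → Ω → ℕ) (r : ℝ≥0)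
    (P : Measure Ω) : Prop where
  measurable : ∀ t, Measurable (N t)
  zero : ∀ᵐ ω ∂P, N 0 ω = 0
  mono : ∀ᵐ ω ∂P, Monotone fun t => N t ω
  rightCts : ∀ᵐ ω ∂P, ∀ t, ContinuousWithinAt (fun s => N s ω) (Set.Ici t) t
  indep : HasIndepIncrements N P
  law : ∀ s t, s ≤ t → HasLaw (fun ω => N t ω - N s ω) (poissonMeasure (r * (t - s))) P

/-! ### Updates as a majority rule -/

section Majority

variable {V : Type*} (G : SimpleGraph V) [G.LocallyFinite]

/-! The proof combines locally stable plus blocks, bootstrap percolation, and favourable time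
windows.

Stability. Tile `ℤ^(d-1)` by cubes of side 2; the cell over such a cube consists of the layers `1,
…, K` above it. A vertex of a cell has one horizontal neighbour per axis inside the cell, and all
its vertical neighbours lie in the cell or the frozen layer. Hence at least `d` neighbours are
inside and at most `d - 1` outside. A finite union of cells that is all `+1` therefore stays `+1`
forever (`IsTrajectory.eq_one_of_stable`, `outDegree_lt_inDegree_slabCell`).

Growth. Call a cell occupied if its initial spins are all `+1`; this has positive probability,
independently over cells. If a cell has, along every horizontal axis, a neighbouring plus cell, then
ties broken in favour of `+1` turn it plus, vertex by vertex from the corner facing those neighbours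
and upwards from the frozen layer. Each vertex so reached sees at least `d` pluses and at most `d`
other spins. Thus plus cells can spread as in modified bootstrap percolation on `ℤ^(d-1)`
(`subset_of_majorityClosed`).

Percolation. At every positive density, large cubes are internally spanned with high probability
(`spanningFailureDecays`), by induction on the dimension: a spanned box grows whenever
lower-dimensional cubes on its faces are spanned. Hence almost surely every cell lies in a finite
internally spanned cube of cells.

Time. For any finite set of vertices there is almost surely a window with enough rings in which all
coins used are `+1` (`ae_exists_isGoodWindow`). Meanwhile the occupied cells have persisted by
stability. During the window they fill the spanned cube (`IsTrajectory.eq_one_of_isGoodWindow`),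
which is itself a union of cells and hence plus from then on. The argument is pathwise and covers
every trajectory, so uniqueness is not needed. -/

open Classical in
/-- The number of neighbours of `x` in `C`. -/
noncomputable def inDegree (C : Set V) (x : V) : ℕ :=
  ((G.neighborFinset x).filter (· ∈ C)).card

open Classical in
/-- The number of neighbours of `x` outside `C`. -/
noncomputable def outDegree (C : Set V) (x : V) : ℕ :=
  ((G.neighborFinset x).filter (· ∉ C)).card

variable {G}

theorem inDegree_mono {C D : Set V} {x : V} (h : ∀ y, G.Adj x y → y ∈ C → y ∈ D) :
    inDegree G C x ≤ inDegree G D x := by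
  classical
  refine Finset.card_le_card fun y hy => ?_
  simp only [Finset.mem_filter, SimpleGraph.mem_neighborFinset] at hy ⊢
  exact ⟨hy.1, h y hy.1 hy.2⟩

theorem outDegree_anti {C D : Set V} {x : V} (h : ∀ y, G.Adj x y → y ∈ C → y ∈ D) :
    outDegree G D x ≤ outDegree G C x := by
  classical
  refine Finset.card_le_card fun y hy => ?_
  simp only [Finset.mem_filter, SimpleGraph.mem_neighborFinset] at hy ⊢
  exact ⟨hy.1, fun hC => hy.2 (h y hy.1 hC)⟩

/-- The current spin of `x` cancels: the outcome is the majority of the neighbours, or the coin in a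
tie. This makes the dynamics monotone in the set of plus spins. -/
theorem updatedSpin_eq (σ : V → ℤˣ) (x : V) (coin : ℤˣ) :
    updatedSpin G σ x coin =
      if outDegree G {y | σ y = 1} x < inDegree G {y | σ y = 1} x then 1
      else if inDegree G {y | σ y = 1} x < outDegree G {y | σ y = 1} x then -1
      else coin := by
  classical
  have hs : ∑ y ∈ G.neighborFinset x, (σ y : ℤ) =
      (inDegree G {y | σ y = 1} x : ℤ) - outDegree G {y | σ y = 1} x := by
    rw [← Finset.sum_filter_add_sum_filter_not (G.neighborFinset x) (· ∈ {y | σ y = 1})]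
    have h1 : ∑ y ∈ (G.neighborFinset x).filter (· ∈ {y | σ y = 1}), (σ y : ℤ) =
        ∑ y ∈ (G.neighborFinset x).filter (· ∈ {y | σ y = 1}), 1 :=
      Finset.sum_congr rfl fun y hy => by
        have h2 : σ y = 1 := (Finset.mem_filter.1 hy).2
        simp [h2]
    have h2 : ∑ y ∈ (G.neighborFinset x).filter (· ∉ {y | σ y = 1}), (σ y : ℤ) =
        ∑ y ∈ (G.neighborFinset x).filter (· ∉ {y | σ y = 1}), (-1) :=
      Finset.sum_congr rfl fun y hy => by
        have h2 : σ y ≠ 1 := (Finset.mem_filter.1 hy).2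
        have h3 : σ y = -1 := (Int.units_eq_one_or (σ y)).resolve_left h2
        simp [h3]
    rw [h1, h2]
    simp [inDegree, outDegree, sub_eq_add_neg]
  unfold updatedSpin energyChange
  rw [← Finset.mul_sum, hs]
  generalize inDegree G {y | σ y = 1} x = a
  generalize outDegree G {y | σ y = 1} x = b
  rcases Int.units_eq_one_or (σ x) with h | h <;> rw [h] <;>
    split_ifs <;> first | rfl | (exfalso; push_cast at *; omega)

theorem updatedSpin_eq_one_of_lt {σ : V → ℤˣ} {x : V} {coin : ℤˣ} {C : Set V}
    (hC : ∀ y, G.Adj x y → y ∈ C → σ y = 1) (h : outDegree G C x < inDegree G C x) :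
    updatedSpin G σ x coin = 1 := by
  rw [updatedSpin_eq, if_pos]
  exact (outDegree_anti hC).trans_lt (h.trans_le (inDegree_mono hC))

theorem updatedSpin_eq_one_of_le {σ : V → ℤˣ} {x : V} {C : Set V}
    (hC : ∀ y, G.Adj x y → y ∈ C → σ y = 1) (h : outDegree G C x ≤ inDegree G C x) :
    updatedSpin G σ x 1 = 1 := by
  have : outDegree G {y | σ y = 1} x ≤ inDegree G {y | σ y = 1} x :=
    (outDegree_anti hC).trans (h.trans (inDegree_mono hC))
  rw [updatedSpin_eq, if_neg this.not_gt]
  split_ifs <;> rfl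

end Majority

/-! ### Deterministic counting paths and their last ring -/

section Clock

/-- The path of a counting process: it starts at `0` and is nondecreasing and right-continuous. -/
structure IsCountingPath (n : ℝ≥0 → ℕ) : Prop where
  zero : n 0 = 0
  mono : Monotone n
  rightCts : ∀ t, ContinuousWithinAt n (Set.Ici t) t

/-- The last ring time up to time `t`. -/
noncomputable def lastRing (n : ℝ≥0 → ℕ) (t : ℝ≥0) : ℝ≥0 := sInf {u | n u = n t}

variable {n : ℝ≥0 → ℕ}

/-- Before `t` the path takes finitely many values, all at most `n t`; from where the largest is
attained it is constant up to `t`. -/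
theorem IsCountingPath.eventually_const_left (h : IsCountingPath n) {t : ℝ≥0} (ht : 0 < t) :
    ∃ s < t, ∀ u, s ≤ u → u < t → n u = n s := by
  have hfin : ((fun s => n s) '' Set.Iio t).Finite :=
    (Set.finite_Iic (n t)).subset (by rintro _ ⟨s, hs, rfl⟩; exact h.mono (le_of_lt hs))
  obtain ⟨_, ⟨s, hs, rfl⟩, hmax⟩ := Set.exists_max_image _ id hfin ⟨_, 0, ht, rfl⟩
  exact ⟨s, hs, fun u hu hut => le_antisymm (hmax _ ⟨u, hut, rfl⟩) (h.mono hu)⟩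

theorem lastRing_le (n : ℝ≥0 → ℕ) (t : ℝ≥0) : lastRing n t ≤ t :=
  csInf_le (OrderBot.bddBelow _) rfl

/-- Right-continuity makes the infimum defining `lastRing` attained. -/
theorem IsCountingPath.apply_lastRing (h : IsCountingPath n) (t : ℝ≥0) :
    n (lastRing n t) = n t := by
  have h1 : ∀ᶠ u in 𝓝[≥] lastRing n t, n u = n (lastRing n t) := by
    have := (h.rightCts (lastRing n t)).tendsto
    rw [nhds_discrete, tendsto_pure] at this
    exact this
  obtain ⟨b, hb, hb'⟩ := (mem_nhdsGE_iff_exists_Ico_subset.1 h1)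
  obtain ⟨u, hu, hub⟩ := exists_lt_of_csInf_lt (s := {u | n u = n t}) ⟨t, rfl⟩ hb
  have : n u = n (lastRing n t) := hb' ⟨csInf_le (OrderBot.bddBelow _) hu, hub⟩
  exact this.symm.trans hu

theorem IsCountingPath.lt_of_lt_lastRing (h : IsCountingPath n) {s t : ℝ≥0}
    (hs : s < lastRing n t) : n s < n (lastRing n t) := by
  rw [h.apply_lastRing]
  refine lt_of_le_of_ne (h.mono (hs.le.trans (lastRing_le n t))) fun h1 => ?_
  exact hs.not_ge (csInf_le (OrderBot.bddBelow _) h1)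

theorem IsCountingPath.lt_lastRing (h : IsCountingPath n) {s t : ℝ≥0} (hs : n s < n t) :
    s < lastRing n t := by
  by_contra! hle
  have := h.mono hle
  rw [h.apply_lastRing] at this
  omega

theorem lastRing_congr {s t : ℝ≥0} (hs : n s = n t) : lastRing n s = lastRing n t := by
  simp only [lastRing, hs]

theorem lastRing_eq_self {t : ℝ≥0} (h : ∀ s < t, n s < n t) : lastRing n t = t :=
  le_antisymm (lastRing_le n t) (le_csInf ⟨t, rfl⟩ fun u hu => by
    by_contra! hut
    exact (h u hut).ne hu)

end Clock

/-! ### Existence of trajectories by a fixed point -/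

section Existence

variable {V : Type*} {G : SimpleGraph V} [G.LocallyFinite] {F : Set V}
  {η : V → ℤˣ} {N : V → ℝ≥0 → ℕ} {c : V → ℕ → ℤˣ}

/-- The vertices having spin `+1` just before time `t`, if `W` is the set of space-time points with
spin `+1`. -/
def leftPlus (W : Set (ℝ≥0 × V)) (t : ℝ≥0) : Set V :=
  {y | ∃ s < t, ∀ u, s < u → u < t → (u, y) ∈ W}

theorem leftPlus_mono {W W' : Set (ℝ≥0 × V)} (h : W ⊆ W') (t : ℝ≥0) :
    leftPlus W t ⊆ leftPlus W' t := by
  rintro y ⟨s, hs, hy⟩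
  exact ⟨s, hs, fun u h1 h2 => h (hy u h1 h2)⟩

variable (G F η N c) in
/-- The monotone operator on sets of space-time points whose fixed points are the trajectories. -/
noncomputable def trajectoryOperator : Set (ℝ≥0 × V) →o Set (ℝ≥0 × V) where
  toFun W := {p | p.2 ∈ F ∨ (N p.2 p.1 = 0 ∧ η p.2 = 1) ∨ (N p.2 p.1 ≠ 0 ∧
    (outDegree G (leftPlus W (lastRing (N p.2) p.1)) p.2 <
        inDegree G (leftPlus W (lastRing (N p.2) p.1)) p.2 ∨
      (outDegree G (leftPlus W (lastRing (N p.2) p.1)) p.2 ≤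
        inDegree G (leftPlus W (lastRing (N p.2) p.1)) p.2 ∧ c p.2 (N p.2 p.1) = 1)))}
  monotone' W W' h := by
    rintro ⟨t, x⟩ hp
    have h1 := inDegree_mono (G := G) (x := x) fun y _ hy =>
      leftPlus_mono h (lastRing (N x) t) hy
    have h2 := outDegree_anti (G := G) (x := x) fun y _ hy =>
      leftPlus_mono h (lastRing (N x) t) hy
    rcases hp with hp | hp | ⟨hp, hp' | ⟨hp', hp''⟩⟩
    · exact Or.inl hp
    · exact Or.inr (Or.inl hp)
    · exact Or.inr (Or.inr ⟨hp, Or.inl (by dsimp only at *; omega)⟩)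
    · exact Or.inr (Or.inr ⟨hp, Or.inr ⟨by dsimp only at *; omega, hp''⟩⟩)

theorem mem_trajectoryOperator {W : Set (ℝ≥0 × V)} {t : ℝ≥0} {x : V} :
    (t, x) ∈ trajectoryOperator G F η N c W ↔
      x ∈ F ∨ (N x t = 0 ∧ η x = 1) ∨ (N x t ≠ 0 ∧
        (outDegree G (leftPlus W (lastRing (N x) t)) x <
            inDegree G (leftPlus W (lastRing (N x) t)) x ∨
          (outDegree G (leftPlus W (lastRing (N x) t)) x ≤
            inDegree G (leftPlus W (lastRing (N x) t)) x ∧ c x (N x t) = 1))) :=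
  Iff.rfl

/-- Monotonicity of the majority rule allows Knaster–Tarski: the least fixed point gives the plus
set of a trajectory. Infinite chains of influence on the infinite graph need no separate control. -/
theorem exists_isTrajectory (hN : ∀ x, IsCountingPath (N x)) :
    ∃ σ, IsTrajectory G F η N c σ := by
  classical
  set Φ := trajectoryOperator G F η N c
  set W := OrderHom.lfp Φ
  have hW : ∀ t x, (t, x) ∈ W ↔ (t, x) ∈ Φ W := fun t x => by rw [Φ.map_lfp]
  have hconst : ∀ s t x, N x s = N x t → ((s, x) ∈ W ↔ (t, x) ∈ W) := by
    intro s t x h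
    rw [hW, hW, mem_trajectoryOperator, mem_trajectoryOperator, h, lastRing_congr h]
  refine ⟨fun t x => if (t, x) ∈ W then 1 else -1, ?_, ?_, ?_, ?_⟩
  · intro x hx t
    rw [if_pos]
    rw [hW]
    exact Or.inl hx
  · intro x hx
    have : (0, x) ∈ W ↔ η x = 1 := by
      rw [hW, mem_trajectoryOperator]
      simp [ hx, (hN x).zero]
    rw [this]
    rcases Int.units_eq_one_or (η x) with h | h <;> simp [h]
  · intro x _ s t _ h
    rw [hconst s t x h]
  · intro x hx t ht hring
    -- The clock of `y`, and with it membership in `W`, is constant just before `t`, so the left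
    -- limit is read off at any `s` close to `t`. Local finiteness then gives one neighbourhood for
    -- all neighbours of `x`.
    have hleft : ∀ y, ∀ᶠ s in 𝓝[<] t, (y ∈ leftPlus W t ↔ (s, y) ∈ W) := by
      intro y
      obtain ⟨r, hr, hr'⟩ := (hN y).eventually_const_left ht
      filter_upwards [Ioo_mem_nhdsLT hr] with s hs
      constructor
      · rintro ⟨s', hs', h⟩
        obtain ⟨u, hu, hut⟩ := exists_between (max_lt hs' hr)
        rw [max_lt_iff] at hu
        refine (hconst u s y ?_).1 (h u hu.1 hut)
        rw [hr' u hu.2.le hut, hr' s hs.1.le hs.2]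
      · intro h
        refine ⟨r, hr, fun u hu hut => (hconst s u y ?_).1 h⟩
        rw [hr' u hu.le hut, hr' s hs.1.le hs.2]
    have hall : ∀ᶠ s in 𝓝[<] t, ∀ y ∈ G.neighborFinset x, (y ∈ leftPlus W t ↔ (s, y) ∈ W) :=
      (Filter.eventually_all_finset _).2 fun y _ => hleft y
    filter_upwards [hall] with s hs
    have h0 : N x t ≠ 0 := by
      have := hring 0 ht
      omega
    have hmem : (t, x) ∈ W ↔ (outDegree G (leftPlus W t) x < inDegree G (leftPlus W t) x ∨
        (outDegree G (leftPlus W t) x ≤ inDegree G (leftPlus W t) x ∧ c x (N x t) = 1)) := by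
      rw [hW, mem_trajectoryOperator]
      simp [ hx, h0, lastRing_eq_self hring]
    have hset : ∀ y, G.Adj x y → (y ∈ leftPlus W t ↔
        y ∈ {y | (if (s, y) ∈ W then (1 : ℤˣ) else -1) = 1}) := by
      intro y hy
      rw [hs y ((G.mem_neighborFinset x y).2 hy)]
      by_cases h : (s, y) ∈ W <;> simp [h]
    have h1 : inDegree G {y | (if (s, y) ∈ W then (1 : ℤˣ) else -1) = 1} x =
        inDegree G (leftPlus W t) x :=
      le_antisymm (inDegree_mono fun y hy => (hset y hy).2)
        (inDegree_mono fun y hy => (hset y hy).1)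
    have h2 : outDegree G {y | (if (s, y) ∈ W then (1 : ℤˣ) else -1) = 1} x =
        outDegree G (leftPlus W t) x :=
      le_antisymm (outDegree_anti fun y hy => (hset y hy).1)
        (outDegree_anti fun y hy => (hset y hy).2)
    rw [updatedSpin_eq, h1, h2]
    rw [hmem]
    rcases Int.units_eq_one_or (c x (N x t)) with h | h <;> rw [h] <;>
      generalize inDegree G (leftPlus W t) x = a <;>
      generalize outDegree G (leftPlus W t) x = b <;>
      split_ifs <;> first | rfl | (exfalso; simp at *; omega)

end Existence

/-! ### Persistence of stable sets and filling during a good window -/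

section Dynamics

variable {V : Type*} {G : SimpleGraph V} [G.LocallyFinite] {F : Set V}
  {η : V → ℤˣ} {N : V → ℝ≥0 → ℕ} {c : V → ℕ → ℤˣ} {σ : ℝ≥0 → V → ℤˣ}

theorem IsTrajectory.exists_eq_updatedSpin (hσ : IsTrajectory G F η N c σ)
    (hN : ∀ x, IsCountingPath (N x)) {x : V} (hx : x ∉ F) {s t : ℝ≥0} (hst : N x s < N x t) :
    ∃ u, s < u ∧ u < t ∧ N x u < N x t ∧ σ t x = updatedSpin G (σ u) x (c x (N x t)) := by
  have hs := (hN x).lt_lastRing hst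
  have hpos : 0 < lastRing (N x) t := lt_of_le_of_lt zero_le hs
  have hup := hσ.update x hx _ hpos fun u hu => (hN x).lt_of_lt_lastRing hu
  have : (𝓝[<] lastRing (N x) t).NeBot := nhdsLT_neBot_of_exists_lt ⟨s, hs⟩
  obtain ⟨u, hu, hu'⟩ := (hup.and (Ioo_mem_nhdsLT hs)).exists
  have h1 := (hN x).apply_lastRing t
  refine ⟨u, hu'.1, hu'.2.trans_le (lastRing_le _ _), ?_, ?_⟩
  · rw [← h1]; exact (hN x).lt_of_lt_lastRing hu'.2
  · rw [hσ.constant x hx _ _ (lastRing_le (N x) t) h1, hu, h1]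

/-- A finite set of vertices each of which has a strict majority of its neighbours in the set or
frozen remains in the state `+1`. -/
theorem IsTrajectory.eq_one_of_stable (hσ : IsTrajectory G F η N c σ)
    (hN : ∀ x, IsCountingPath (N x)) {A : Finset V}
    (hA : ∀ x ∈ A, outDegree G (A ∪ F) x < inDegree G (A ∪ F) x)
    {s : ℝ≥0} (hs : ∀ x ∈ A, σ s x = 1) {t : ℝ≥0} (hst : s ≤ t) : ∀ x ∈ A, σ t x = 1 := by
  -- Induction on the total number of rings in `A` replaces induction on real time: just before the
  -- last ring at `x` this total is strictly smaller.
  induction h : ∑ x ∈ A, N x t using Nat.strong_induction_on generalizing t with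
  | _ k ih =>
    intro x hx
    by_cases hxF : x ∈ F
    · exact hσ.frozen x hxF t
    rcases ((hN x).mono hst).eq_or_lt with heq | hlt
    · rw [hσ.constant x hxF s t hst heq, hs x hx]
    obtain ⟨u, hsu, hut, hNu, hup⟩ := hσ.exists_eq_updatedSpin hN hxF hlt
    rw [hup]
    refine updatedSpin_eq_one_of_lt (C := A ∪ F) ?_ (hA x hx)
    rintro y - (hy | hy)
    · refine ih _ ?_ hsu.le rfl y hy
      rw [← h]
      exact Finset.sum_lt_sum (fun y _ => (hN y).mono hut.le) ⟨x, hx, hNu⟩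
    · exact hσ.frozen y hy u

/-- `C` contains every vertex of `U` at least half of whose neighbours are in `C`. -/
def MajorityClosed (G : SimpleGraph V) [G.LocallyFinite] (U C : Set V) : Prop :=
  ∀ x ∈ U, outDegree G C x ≤ inDegree G C x → x ∈ C

/-- From time `r` on there are `|U| + 1` unit time intervals in each of which the clocks of all
vertices of `U` ring, and all coins tossed at these vertices up to the end show `+1`. -/
def IsGoodWindow (U : Finset V) (N : V → ℝ≥0 → ℕ) (c : V → ℕ → ℤˣ) (r : ℕ) : Prop :=
  (∀ x ∈ U, ∀ k < U.card + 1, N x ↑(r + k) < N x ↑(r + k + 1)) ∧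
    ∀ x ∈ U, ∀ n, N x ↑r < n → n ≤ N x ↑(r + U.card + 1) → c x n = 1

/-- The seed `A` is plus at all times by stability. The set of vertices that stay plus until the end
of the window can only grow from one unit interval to the next; once it stalls it is majority
closed, hence contains `U`. -/
theorem IsTrajectory.eq_one_of_isGoodWindow (hσ : IsTrajectory G F η N c σ)
    (hN : ∀ x, IsCountingPath (N x)) {A U : Finset V} (hUF : ∀ x ∈ U, x ∉ F)
    (hAη : ∀ x ∈ A, η x = 1) (hAU : A ⊆ U)
    (hA : ∀ x ∈ A, outDegree G (A ∪ F) x < inDegree G (A ∪ F) x)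
    (hU : ∀ x ∈ U, outDegree G (U ∪ F) x < inDegree G (U ∪ F) x)
    (hspan : ∀ C : Set V, ↑A ∪ F ⊆ C → MajorityClosed G U C → ↑U ⊆ C)
    {r : ℕ} (hr : IsGoodWindow U N c r) {t : ℝ≥0} (ht : ↑(r + U.card + 1) ≤ t) :
    ∀ x ∈ U, σ t x = 1 := by
  classical
  have hAt : ∀ t, ∀ x ∈ A, σ t x = 1 := fun t =>
    hσ.eq_one_of_stable hN hA (s := 0)
      (fun x hx => by rw [hσ.initial x (hUF x (hAU hx)), hAη x hx]) zero_le
  refine hσ.eq_one_of_stable hN hU (s := ↑(r + U.card + 1)) ?_ ht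
  set e : ℝ≥0 := ↑(r + U.card + 1) with he
  set S : ℕ → Finset V := fun k => U.filter fun x =>
    ∀ t : ℝ≥0, ↑(r + k) ≤ t → t ≤ e → σ t x = 1 with hS
  have hmono : ∀ k, S k ⊆ S (k + 1) := by
    intro k x hx
    simp only [hS, Finset.mem_filter] at hx ⊢
    refine ⟨hx.1, fun t ht => hx.2 t (le_trans ?_ ht)⟩
    exact_mod_cast (by omega : r + k ≤ r + (k + 1))
  -- Pigeonhole: `|U| + 1` strict inclusions among subsets of `U` are impossible, which is why the
  -- window has that many intervals.
  obtain ⟨k, hk, hSk⟩ : ∃ k < U.card + 1, S (k + 1) ⊆ S k := by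
    by_contra! h
    have hcard : ∀ k ≤ U.card + 1, k ≤ (S k).card := by
      intro k
      induction k with
      | zero => simp
      | succ k ih =>
        intro hk
        have := Finset.card_lt_card ((hmono k).ssubset_of_not_subset (h k (by omega)))
        have := ih (by omega)
        omega
    have h1 := hcard (U.card + 1) le_rfl
    have h2 := Finset.card_le_card (Finset.filter_subset
      (fun x => ∀ t : ℝ≥0, ↑(r + (U.card + 1)) ≤ t → t ≤ e → σ t x = 1) U)
    simp only [hS] at h1
    omega
  have hke : ((r + k : ℕ) : ℝ≥0) ≤ e := by
    rw [he]; exact_mod_cast (by omega)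
  have key : (U : Set V) ⊆ ↑(S k) ∪ F := by
    refine hspan _ ?_ ?_
    · rintro x (hx | hx)
      · exact Or.inl (Finset.mem_coe.2 (Finset.mem_filter.2 ⟨hAU hx, fun t _ _ => hAt t x hx⟩))
      · exact Or.inr hx
    -- Such an `x` rings between `r + k` and `r + k + 1`, and each of its updates from `r + k` until
    -- `e` yields `+1`, ties included. So it lies in `S (k + 1)`, hence in `S k`.
    · intro x hx hmaj
      refine Or.inl (hSk (Finset.mem_filter.2 ⟨hx, fun t ht hte => ?_⟩))
      have hring : N x ↑(r + k) < N x t :=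
        (hr.1 x hx k hk).trans_le ((hN x).mono (by exact_mod_cast ht))
      obtain ⟨u, hu, hut, -, hup⟩ := hσ.exists_eq_updatedSpin hN (hUF x hx) hring
      have hc : c x (N x t) = 1 := by
        refine hr.2 x hx _ (lt_of_le_of_lt ((hN x).mono ?_) hring) ((hN x).mono hte)
        exact_mod_cast (by omega)
      rw [hup, hc]
      refine updatedSpin_eq_one_of_le (C := ↑(S k) ∪ F) ?_ hmaj
      rintro y - (hy | hy)
      · exact (Finset.mem_filter.1 hy).2 u hu.le (hut.le.trans hte)
      · exact hσ.frozen y hy u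
  intro x hx
  rcases key hx with h | h
  · exact (Finset.mem_filter.1 h).2 e hke le_rfl
  · exact absurd h (hUF x hx)

end Dynamics

/-! ### Deterministic modified bootstrap percolation -/

section Bootstrap

variable {ι : Type*} [DecidableEq ι]

/-- `B` is internally spanned by `O` for the modified bootstrap percolation with axes in `I`, in
which a site gets occupied as soon as, for every axis in `I`, at least one of its two neighbours
along this axis is occupied. -/
def IsSpanned (I : Finset ι) (O B : Set (ι → ℤ)) : Prop :=
  ∀ C : Set (ι → ℤ), O ∩ B ⊆ C →
    (∀ x ∈ B, (∀ i ∈ I, x + Pi.single i 1 ∈ C ∩ B ∨ x - Pi.single i 1 ∈ C ∩ B) → x ∈ C) → B ⊆ C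

variable {I : Finset ι} {O B : Set (ι → ℤ)}

theorem IsSpanned.of_subset (h : B ⊆ O) : IsSpanned I O B :=
  fun _ hC _ _ hx => hC ⟨h hx, hx⟩

/-- Without axes the occupation rule is vacuous; this is the base case of the induction on
dimension. -/
theorem isSpanned_empty (O B : Set (ι → ℤ)) : IsSpanned ∅ O B :=
  fun _ _ hC _ hx => hC _ hx (by simp)

theorem IsSpanned.congr {O' : Set (ι → ℤ)} (h : IsSpanned I O B) (hO : O ∩ B ⊆ O') :
    IsSpanned I O' B :=
  fun C hC => h C fun _ hx => hC ⟨hO hx, hx.2⟩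

/-- A set covered by internally spanned subsets is internally spanned. -/
theorem isSpanned_of_forall_exists
    (h : ∀ x ∈ B, ∃ B' ⊆ B, x ∈ B' ∧ IsSpanned I O B') : IsSpanned I O B := by
  intro C hC hcl x hx
  obtain ⟨B', hB', hxB', hsp⟩ := h x hx
  refine hsp C (fun y hy => hC ⟨hy.1, hB' hy.2⟩) (fun y hy hrule => ?_) hxB'
  exact hcl y (hB' hy) fun i hi =>
    (hrule i hi).imp (fun h => ⟨h.1, hB' h.2⟩) (fun h => ⟨h.1, hB' h.2⟩)

/-- A spanned set can be enlarged by an adjacent face that is spanned with one axis less. -/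
theorem IsSpanned.union_face {D : Set (ι → ℤ)} {i : ι} (hB : IsSpanned I O B)
    (hD : IsSpanned (I.erase i) O D)
    (hadj : ∀ x ∈ D, x + Pi.single i 1 ∈ B ∨ x - Pi.single i 1 ∈ B) : IsSpanned I O (B ∪ D) := by
  intro C hC hcl
  have hBC : B ⊆ C := by
    refine hB C (fun y hy => hC ⟨hy.1, Or.inl hy.2⟩) fun y hy hrule => ?_
    exact hcl y (Or.inl hy) fun j hj =>
      (hrule j hj).imp (fun h => ⟨h.1, Or.inl h.2⟩) (fun h => ⟨h.1, Or.inl h.2⟩)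
  refine Set.union_subset hBC (hD C (fun y hy => hC ⟨hy.1, Or.inr hy.2⟩) fun y hy hrule => ?_)
  refine hcl y (Or.inr hy) fun j hj => ?_
  -- Along the axis `i` the neighbour in `B` suffices, so only the remaining axes must be handled
  -- within `D`.
  by_cases hji : j = i
  · subst hji
    exact (hadj y hy).imp (fun h => ⟨hBC h, Or.inl h⟩) (fun h => ⟨hBC h, Or.inl h⟩)
  · exact (hrule j (Finset.mem_erase.2 ⟨hji, hj⟩)).imp
      (fun h => ⟨h.1, Or.inr h.2⟩) (fun h => ⟨h.1, Or.inr h.2⟩)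

/-- The cube with lower corner `a`, extending by `n` in the directions of the axes in `I`. -/
def axisCube (a : ι → ℤ) (I : Finset ι) (n : ℕ) : Set (ι → ℤ) :=
  Set.Icc a (fun i => if i ∈ I then a i + n else a i)

theorem mem_axisCube {a x : ι → ℤ} {n : ℕ} :
    x ∈ axisCube a I n ↔ ∀ i, a i ≤ x i ∧ x i ≤ if i ∈ I then a i + n else a i := by
  simp only [axisCube, Set.mem_Icc, Pi.le_def, forall_and]

/-- A box all of whose subcubes of a given side are spanned is spanned. -/
theorem isSpanned_Icc_of_axisCube {a b : ι → ℤ} {l : ℕ} (hoff : ∀ i ∉ I, a i = b i)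
    (hlen : ∀ i ∈ I, a i + l ≤ b i)
    (h : ∀ y, axisCube y I l ⊆ Set.Icc a b → IsSpanned I O (axisCube y I l)) :
    IsSpanned I O (Set.Icc a b) := by
  refine isSpanned_of_forall_exists fun x hx => ?_
  have hx1 := hx.1
  have hx2 := hx.2
  rw [Pi.le_def] at hx1 hx2
  set y : ι → ℤ := fun i => if i ∈ I then min (x i) (b i - l) else a i with hy
  have hsub : axisCube y I l ⊆ Set.Icc a b := by
    intro z hz
    rw [mem_axisCube] at hz
    rw [Set.mem_Icc, Pi.le_def, Pi.le_def, ← forall_and]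
    intro i
    have h1 := hz i
    have h2 := hx1 i
    have h3 := hx2 i
    simp only [hy] at h1
    by_cases hi : i ∈ I
    · have h4 := hlen i hi
      simp only [hi, if_true] at h1
      omega
    · have h4 := hoff i hi
      simp only [hi, if_false] at h1
      omega
  refine ⟨_, hsub, ?_, h y hsub⟩
  rw [mem_axisCube]
  intro i
  have h2 := hx1 i
  have h3 := hx2 i
  simp only [hy]
  by_cases hi : i ∈ I
  · have h4 := hlen i hi
    simp only [hi, if_true]
    omega
  · have h4 := hoff i hi
    simp only [hi, if_false]
    omega

/-- A spanned box grows to fill a larger box if all lower-dimensional cubes of a given side in the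
larger box, orthogonal to an axis and outside the smaller box in this direction, are spanned. -/
theorem IsSpanned.grow [Fintype ι] {a b a' b' : ι → ℤ} {l : ℕ} (ha : a' ≤ a) (hb : b ≤ b')
    (hoff : ∀ i ∉ I, a' i = b' i) (hlen : ∀ i ∈ I, a i + l ≤ b i) (hab : a ≤ b)
    (hB : IsSpanned I O (Set.Icc a b))
    (hface : ∀ i ∈ I, ∀ y, axisCube y (I.erase i) l ⊆ Set.Icc a' b' → (y i < a i ∨ b i < y i) →
      IsSpanned (I.erase i) O (axisCube y (I.erase i) l)) :
    IsSpanned I O (Set.Icc a' b') := by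
  -- Induction on the total width still missing: each step adds one layer on one side.
  induction h : (∑ i, ((b' i - b i) + (a i - a' i))).toNat using Nat.strong_induction_on
    generalizing a b with
  | _ k ih =>
    rw [Pi.le_def] at ha hb hab
    have hpos : ∀ i ∈ Finset.univ, 0 ≤ (b' i - b i) + (a i - a' i) := fun i _ => by
      have := ha i; have := hb i; omega
    by_cases hex : ∃ i, a' i < a i ∨ b i < b' i
    swap
    · push Not at hex
      have h1 : a = a' := funext fun i => le_antisymm (hex i).1 (ha i)
      have h2 : b = b' := funext fun i => le_antisymm (hb i) (hex i).2
      rwa [← h1, ← h2]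
    obtain ⟨i, hi⟩ := hex
    have hiI : i ∈ I := by
      by_contra hiI
      have := hoff i hiI; have := ha i; have := hb i; have := hab i
      omega
    have hoff' : ∀ j ∉ I, a j = b j := fun j hj => by
      have := hoff j hj; have := ha j; have := hb j; have := hab j
      omega
    -- the enlarged box and its new face, at height `v`
    obtain ⟨a₁, b₁, v, ha₁, hb₁, ha₁', hb₁', hv, hvi, hsum⟩ : ∃ a₁ b₁ : ι → ℤ, ∃ v : ℤ,
        (∀ j, j ≠ i → a₁ j = a j) ∧ (∀ j, j ≠ i → b₁ j = b j) ∧ a' i ≤ a₁ i ∧ b₁ i ≤ b' i ∧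
        (v < a i ∨ b i < v) ∧
        (∀ x, a₁ i ≤ x ∧ x ≤ b₁ i ↔ ((a i ≤ x ∧ x ≤ b i) ∨ x = v)) ∧
        ((b' i - b₁ i) + (a₁ i - a' i) < (b' i - b i) + (a i - a' i) ∧
          ((v + 1 = a i) ∨ (v - 1 = b i))) := by
      have := hab i
      rcases hi with hi | hi
      · refine ⟨Function.update a i (a i - 1), b, a i - 1, ?_, fun _ _ => rfl, ?_, hb i, ?_, ?_, ?_⟩
        · intro j hj; simp [hj]
        · simp; omega
        · omega
        · intro x; simp; omega
        · simp
      · refine ⟨a, Function.update b i (b i + 1), b i + 1, fun _ _ => rfl, ?_, ha i, ?_, ?_, ?_, ?_⟩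
        · intro j hj; simp [hj]
        · simp; omega
        · omega
        · intro x; simp; omega
        · simp
    have hvrange : a' i ≤ v ∧ v ≤ b' i := by
      have := (hvi v).2 (Or.inr rfl); omega
    have hle_i : a₁ i ≤ a i ∧ b i ≤ b₁ i := by
      have h1 := (hvi (a i)).2 (Or.inl ⟨le_rfl, hab i⟩)
      have h2 := (hvi (b i)).2 (Or.inl ⟨hab i, le_rfl⟩)
      omega
    have hle : ∀ j, a₁ j ≤ a j ∧ b j ≤ b₁ j ∧ a' j ≤ a₁ j ∧ b₁ j ≤ b' j := by
      intro j
      by_cases hj : j = i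
      · subst hj; exact ⟨hle_i.1, hle_i.2, ha₁', hb₁'⟩
      · rw [ha₁ j hj, hb₁ j hj]; exact ⟨le_rfl, le_rfl, ha j, hb j⟩
    -- The new layer has the extents of the current box along the other axes, at least `l` each, so
    -- cubes of side `l` cover it.
    have hD : IsSpanned (I.erase i) O
        (Set.Icc (Function.update a i v) (Function.update b i v)) := by
      have hsubD : Set.Icc (Function.update a i v) (Function.update b i v) ⊆ Set.Icc a' b' := by
        refine Set.Icc_subset_Icc (Pi.le_def.2 fun j => ?_) (Pi.le_def.2 fun j => ?_)
        · by_cases hj : j = i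
          · subst hj; simpa using hvrange.1
          · simpa [hj] using ha j
        · by_cases hj : j = i
          · subst hj; simpa using hvrange.2
          · simpa [hj] using hb j
      refine isSpanned_Icc_of_axisCube (l := l) ?_ ?_ ?_
      · intro j hj
        by_cases hji : j = i
        · subst hji; simp
        · simpa [hji] using hoff' j fun hjI => hj (Finset.mem_erase.2 ⟨hji, hjI⟩)
      · intro j hj
        rw [Finset.mem_erase] at hj
        simpa [hj.1] using hlen j hj.2
      · intro y hy
        refine hface i hiI y (hy.trans hsubD) ?_
        have hyD := hy (show y ∈ axisCube y (I.erase i) l by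
          rw [mem_axisCube]; intro j; split_ifs <;> omega)
        have h1 := hyD.1 i
        have h2 := hyD.2 i
        simp only [Function.update_self] at h1 h2
        omega
    have hBD : IsSpanned I O (Set.Icc a₁ b₁) := by
      have hunion : Set.Icc a₁ b₁ = Set.Icc a b ∪
          Set.Icc (Function.update a i v) (Function.update b i v) := by
        ext x
        simp only [Set.mem_Icc, Set.mem_union, Pi.le_def, ← forall_and]
        constructor
        · intro hx
          rcases (hvi (x i)).1 (hx i) with hxi | hxi
          · left
            intro j
            by_cases hj : j = i
            · subst hj; exact hxi
            · have := hx j; rwa [ha₁ j hj, hb₁ j hj] at this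
          · right
            intro j
            by_cases hj : j = i
            · subst hj; simp [hxi]
            · have := hx j; rw [ha₁ j hj, hb₁ j hj] at this; simpa [hj] using this
        · rintro (hx | hx) j
          · have := hx j; have := hle j; omega
          · by_cases hj : j = i
            · subst hj
              refine (hvi _).2 (Or.inr ?_)
              have := hx j; simp at this; omega
            · have := hx j; rw [ha₁ j hj, hb₁ j hj]; simpa [hj] using this
      rw [hunion]
      refine hB.union_face hD fun x hx => ?_
      simp only [Set.mem_Icc, Pi.le_def, ← forall_and] at hx
      have hxi := hx i
      simp only [Function.update_self] at hxi
      have hrest : ∀ j, j ≠ i → a j ≤ x j ∧ x j ≤ b j := fun j hj => by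
        have := hx j; simpa [hj] using this
      refine hsum.2.imp (fun hv1 => ?_) (fun hv1 => ?_) <;>
      · simp only [Set.mem_Icc, Pi.le_def, ← forall_and]
        intro j
        by_cases hj : j = i
        · subst hj
          have := hab j
          simp
          omega
        · simpa [hj] using hrest j hj
    refine ih _ ?_ (Pi.le_def.2 fun j => (hle j).2.2.1) (Pi.le_def.2 fun j => (hle j).2.2.2) ?_ ?_
      hBD ?_ rfl
    · rw [← h]
      have hlt : ∑ j, ((b' j - b₁ j) + (a₁ j - a' j)) < ∑ j, ((b' j - b j) + (a j - a' j)) :=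
        Finset.sum_lt_sum (fun j _ => by have := hle j; omega) ⟨i, Finset.mem_univ i, hsum.1⟩
      have h0 : 0 ≤ ∑ j, ((b' j - b₁ j) + (a₁ j - a' j)) :=
        Finset.sum_nonneg fun j _ => by have := hle j; omega
      omega
    · intro j hj
      have := hlen j hj; have := hle j; omega
    · exact Pi.le_def.2 fun j => by have := hab j; have := hle j; omega
    · intro j hj y hy hyj
      refine hface j hj y hy ?_
      have := hle j; omega

end Bootstrap

/-! ### Neighbour counts in the slab and cells of side 2 -/

section SlabGeometry

variable {d K : ℕ}

theorem slabGraph_adj_iff {x y : SlabVertex d K} : (slabGraph d K).Adj x y ↔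
    (∑ i, |x.1 i - y.1 i|) + |((x.2 : ℕ) : ℤ) - ((y.2 : ℕ) : ℤ)| = 1 :=
  Iff.rfl

theorem slabGraph_adj_side {u : Fin (d - 1) → ℤ} {k : Fin (K + 1)} {i : Fin (d - 1)} {s : ℤ}
    (hs : s = 1 ∨ s = -1) : (slabGraph d K).Adj (u, k) (u + Pi.single i s, k) := by
  rw [slabGraph_adj_iff, Finset.sum_eq_single i]
  · rcases hs with rfl | rfl <;> simp
  · intro j _ hj
    simp [hj]
  · simp

theorem slabGraph_adj_vertical {u : Fin (d - 1) → ℤ} {k k' : Fin (K + 1)}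
    (h : (k' : ℕ) + 1 = k) : (slabGraph d K).Adj (u, k) (u, k') := by
  rw [slabGraph_adj_iff, ← h]
  simp

theorem slabGraph_adj_cases {x y : SlabVertex d K} (h : (slabGraph d K).Adj x y) :
    (∃ i, ∃ s : ℤ, (s = 1 ∨ s = -1) ∧ y = (x.1 + Pi.single i s, x.2)) ∨
      (y.1 = x.1 ∧ ((y.2 : ℕ) + 1 = x.2 ∨ (x.2 : ℕ) + 1 = y.2)) := by
  have h' := slabGraph_adj_iff.1 h
  by_cases hxy : x.1 = y.1
  · right
    simp only [hxy, sub_self, abs_zero, Finset.sum_const_zero, zero_add] at h'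
    refine ⟨hxy.symm, ?_⟩
    rcases (abs_eq (by norm_num)).1 h' with h1 | h1 <;> omega
  · left
    obtain ⟨i, hi⟩ := Function.ne_iff.1 hxy
    have hsplit := Finset.add_sum_erase Finset.univ (fun j => |x.1 j - y.1 j|) (Finset.mem_univ i)
    have hi1 : 1 ≤ |x.1 i - y.1 i| := Int.one_le_abs (sub_ne_zero.2 hi)
    have hrest0 : 0 ≤ ∑ j ∈ Finset.univ.erase i, |x.1 j - y.1 j| :=
      Finset.sum_nonneg fun j _ => abs_nonneg _
    have hk0 := abs_nonneg (((x.2 : ℕ) : ℤ) - ((y.2 : ℕ) : ℤ))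
    have hrest : ∑ j ∈ Finset.univ.erase i, |x.1 j - y.1 j| = 0 := by omega
    have hk : |((x.2 : ℕ) : ℤ) - ((y.2 : ℕ) : ℤ)| = 0 := by omega
    have hi2 : |x.1 i - y.1 i| = 1 := by omega
    rw [Finset.sum_eq_zero_iff_of_nonneg fun j _ => abs_nonneg _] at hrest
    refine ⟨i, y.1 i - x.1 i, ?_, ?_⟩
    · rcases (abs_eq (by norm_num)).1 hi2 with h1 | h1 <;> omega
    · refine Prod.ext (funext fun j => ?_) (Fin.ext ?_)
      · by_cases hj : j = i
        · subst hj; simp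
        · have := hrest j (Finset.mem_erase.2 ⟨hj, Finset.mem_univ j⟩)
          rw [abs_eq_zero] at this
          simp [hj]; omega
      · rw [abs_eq_zero] at hk
        simp only
        omega

variable {u : Fin (d - 1) → ℤ} {k : Fin (K + 1)} {s : Fin (d - 1) → ℤ} {C : Set (SlabVertex d K)}

theorem le_inDegree_slab (hk : k ≠ 0) (hs : ∀ i, s i = 1 ∨ s i = -1)
    (hside : ∀ i, (u + Pi.single i (s i), k) ∈ C)
    (hdown : ∀ k' : Fin (K + 1), (k' : ℕ) + 1 = k → (u, k') ∈ C) :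
    d - 1 + 1 ≤ inDegree (slabGraph d K) C (u, k) := by
  classical
  have hk' : (k : ℕ) ≠ 0 := fun h => hk (Fin.ext h)
  set k' : Fin (K + 1) := ⟨k - 1, by omega⟩ with hk'def
  have hkk' : (k' : ℕ) + 1 = k := by simp only [hk'def]; omega
  -- The `d` neighbours that are counted: `none` is the vertex below, `some i` the chosen one along
  -- the axis `i`.
  set f : Option (Fin (d - 1)) → SlabVertex d K := fun o =>
    o.elim (u, k') fun i => (u + Pi.single i (s i), k) with hf
  have hne : k' ≠ k := fun h => by rw [h] at hkk'; omega
  have hinj : Function.Injective f := by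
    rintro (_ | i) (_ | j) h
    · rfl
    · exact absurd (congrArg Prod.snd h) hne
    · exact absurd (congrArg Prod.snd h) hne.symm
    · by_contra hij
      have h1 := congrFun (congrArg Prod.fst h) i
      have hij' : i ≠ j := fun h => hij (by rw [h])
      simp only [hf, Option.elim, Pi.add_apply, Pi.single_eq_same, Pi.single_eq_of_ne hij'] at h1
      have := hs i
      omega
  calc d - 1 + 1 = (Finset.univ.image f).card := by
        rw [Finset.card_image_of_injective _ hinj]; simp
    _ ≤ _ := Finset.card_le_card fun y hy => by
        obtain ⟨o, -, rfl⟩ := Finset.mem_image.1 hy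
        rw [Finset.mem_filter, SimpleGraph.mem_neighborFinset]
        rcases o with _ | i
        · exact ⟨slabGraph_adj_vertical hkk', hdown k' hkk'⟩
        · exact ⟨slabGraph_adj_side (hs i), hside i⟩

theorem outDegree_slab_eq (hs : ∀ i, s i = 1 ∨ s i = -1)
    (hside : ∀ i, (u + Pi.single i (s i), k) ∈ C)
    (hdown : ∀ k' : Fin (K + 1), (k' : ℕ) + 1 = k → (u, k') ∈ C) {y : SlabVertex d K}
    (hy : (slabGraph d K).Adj (u, k) y) (hyC : y ∉ C) :
    (∃ i, y = (u + Pi.single i (-s i), k)) ∨ (y.1 = u ∧ (y.2 : ℕ) = k + 1) := by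
  rcases slabGraph_adj_cases hy with ⟨i, t, ht, rfl⟩ | ⟨h1, h2 | h2⟩
  · left
    refine ⟨i, ?_⟩
    have hts : t ≠ s i := fun h => hyC (h ▸ hside i)
    have : t = -s i := by have := hs i; omega
    rw [this]
  · exact absurd (h1 ▸ hdown y.2 h2 : (y.1, y.2) ∈ C) hyC
  · exact Or.inr ⟨h1, h2.symm⟩

theorem outDegree_slab_le (hs : ∀ i, s i = 1 ∨ s i = -1)
    (hside : ∀ i, (u + Pi.single i (s i), k) ∈ C)
    (hdown : ∀ k' : Fin (K + 1), (k' : ℕ) + 1 = k → (u, k') ∈ C) :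
    outDegree (slabGraph d K) C (u, k) ≤ d - 1 + 1 := by
  classical
  -- In the top layer the value `0` is a dummy; it only enlarges the upper bound.
  set k' : Fin (K + 1) := if h : (k : ℕ) + 1 < K + 1 then ⟨k + 1, h⟩ else 0 with hk'
  set f : Option (Fin (d - 1)) → SlabVertex d K := fun o =>
    o.elim (u, k') fun i => (u + Pi.single i (-s i), k) with hf
  calc _ ≤ (Finset.univ.image f).card := Finset.card_le_card fun y hy => by
        rw [Finset.mem_filter, SimpleGraph.mem_neighborFinset] at hy
        rw [Finset.mem_image]
        rcases outDegree_slab_eq hs hside hdown hy.1 hy.2 with ⟨i, rfl⟩ | ⟨h1, h2⟩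
        · exact ⟨some i, Finset.mem_univ _, rfl⟩
        · refine ⟨none, Finset.mem_univ _, Prod.ext h1.symm (Fin.ext ?_)⟩
          have h3 : (k : ℕ) + 1 < K + 1 := by have := y.2.2; omega
          simp only [hf, Option.elim, hk', dif_pos h3, h2]
    _ ≤ _ := Finset.card_image_le.trans (by simp)

theorem outDegree_slab_le_of_up (hs : ∀ i, s i = 1 ∨ s i = -1)
    (hside : ∀ i, (u + Pi.single i (s i), k) ∈ C)
    (hvert : ∀ k' : Fin (K + 1), (k' : ℕ) + 1 = k ∨ (k' : ℕ) = k + 1 → (u, k') ∈ C) :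
    outDegree (slabGraph d K) C (u, k) ≤ d - 1 := by
  classical
  calc _ ≤ (Finset.univ.image fun i => ((u + Pi.single i (-s i), k) : SlabVertex d K)).card :=
        Finset.card_le_card fun y hy => by
          rw [Finset.mem_filter, SimpleGraph.mem_neighborFinset] at hy
          rw [Finset.mem_image]
          rcases outDegree_slab_eq hs hside (fun k' h => hvert k' (Or.inl h)) hy.1 hy.2
            with ⟨i, rfl⟩ | ⟨h1, h2⟩
          · exact ⟨i, Finset.mem_univ _, rfl⟩
          · exact absurd (h1 ▸ hvert y.2 (Or.inr h2) : (y.1, y.2) ∈ C) hy.2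
    _ ≤ _ := Finset.card_image_le.trans (by simp)

/-- The non-frozen vertices above the cube of side `2` with lower corner `2 z`. -/
noncomputable def slabCell (d K : ℕ) (z : Fin (d - 1) → ℤ) : Finset (SlabVertex d K) :=
  Finset.Icc (fun i => 2 * z i) (fun i => 2 * z i + 1) ×ˢ Finset.univ.erase 0

theorem mem_slabCell {z : Fin (d - 1) → ℤ} :
    (u, k) ∈ slabCell d K z ↔ (∀ i, u i / 2 = z i) ∧ k ≠ 0 := by
  rw [slabCell, Finset.mem_product, Finset.mem_Icc, Pi.le_def, Pi.le_def, ← forall_and]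
  simp only [Finset.mem_erase, Finset.mem_univ, and_true]
  refine and_congr_left fun _ => forall_congr' fun i => ?_
  omega

theorem slabCell_disjoint {z z' : Fin (d - 1) → ℤ} (h : z ≠ z') :
    Disjoint (slabCell d K z) (slabCell d K z') := by
  rw [Finset.disjoint_left]
  rintro ⟨u, k⟩ h1 h2
  rw [mem_slabCell] at h1 h2
  exact h (funext fun i => (h1.1 i).symm.trans (h2.1 i))

/-- A union of cells is stable. -/
theorem outDegree_lt_inDegree_slabCell (Z : Finset (Fin (d - 1) → ℤ)) :
    ∀ x ∈ Z.biUnion (slabCell d K),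
      outDegree (slabGraph d K) (↑(Z.biUnion (slabCell d K)) ∪ slabBottom d K) x <
        inDegree (slabGraph d K) (↑(Z.biUnion (slabCell d K)) ∪ slabBottom d K) x := by
  rintro ⟨u, k⟩ hx
  obtain ⟨z, hz, hx⟩ := Finset.mem_biUnion.1 hx
  rw [mem_slabCell] at hx
  have hmem : ∀ v : Fin (d - 1) → ℤ, (∀ i, v i / 2 = z i) → ∀ k',
      ((v, k') : SlabVertex d K) ∈ (↑(Z.biUnion (slabCell d K)) ∪ slabBottom d K : Set _) := by
    intro v hv k'
    by_cases hk' : k' = 0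
    · exact Or.inr hk'
    · exact Or.inl (Finset.mem_coe.2 (Finset.mem_biUnion.2 ⟨z, hz, mem_slabCell.2 ⟨hv, hk'⟩⟩))
  -- The parity of `u i` decides which of the two neighbours along the axis `i` shares the cell.
  set s : Fin (d - 1) → ℤ := fun i => if u i % 2 = 0 then 1 else -1 with hs
  have hs1 : ∀ i, s i = 1 ∨ s i = -1 := fun i => by simp only [hs]; split_ifs <;> simp
  have hside : ∀ i, (u + Pi.single i (s i), k) ∈
      (↑(Z.biUnion (slabCell d K)) ∪ slabBottom d K : Set (SlabVertex d K)) := by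
    intro i
    refine hmem _ (fun j => ?_) k
    by_cases hj : j = i
    · subst hj
      have := hx.1 j
      simp only [Pi.add_apply, Pi.single_eq_same, hs]
      split_ifs <;> omega
    · simpa [hj] using hx.1 j
  have h1 := le_inDegree_slab hx.2 hs1 hside fun k' _ => hmem u hx.1 k'
  have h2 := outDegree_slab_le_of_up hs1 hside fun k' _ => hmem u hx.1 k'
  omega

/-- If the occupied cells internally span a set of cells in the sense of modified bootstrap
percolation, then the corresponding vertices span with respect to the majority rule. -/
theorem subset_of_majorityClosed {O : Set (Fin (d - 1) → ℤ)} {Z Z' : Finset (Fin (d - 1) → ℤ)}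
    (hsp : IsSpanned Finset.univ O ↑Z) (hZ' : O ∩ ↑Z ⊆ ↑Z') {C : Set (SlabVertex d K)}
    (hC : ↑(Z'.biUnion (slabCell d K)) ∪ slabBottom d K ⊆ C)
    (hmaj : MajorityClosed (slabGraph d K) (Z.biUnion (slabCell d K)) C) :
    ↑(Z.biUnion (slabCell d K)) ⊆ C := by
  have key : (Z : Set (Fin (d - 1) → ℤ)) ⊆
      {z | ∀ u : Fin (d - 1) → ℤ, (∀ i, u i / 2 = z i) → ∀ k, (u, k) ∈ C} := by
    refine hsp _ ?_ ?_
    · intro z hz u hu k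
      refine hC ?_
      by_cases hk : k = 0
      · exact Or.inr hk
      · exact Or.inl (Finset.mem_coe.2
          (Finset.mem_biUnion.2 ⟨z, hZ' hz, mem_slabCell.2 ⟨hu, hk⟩⟩))
    · intro z hz hrule
      have hsex : ∀ i, ∃ s : ℤ, (s = 1 ∨ s = -1) ∧ ∀ u : Fin (d - 1) → ℤ,
          (∀ j, u j / 2 = (z + Pi.single i s : Fin (d - 1) → ℤ) j) → ∀ k, (u, k) ∈ C := by
        intro i
        rcases hrule i (Finset.mem_univ i) with h | h
        · exact ⟨1, Or.inl rfl, h.1⟩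
        · refine ⟨-1, Or.inr rfl, ?_⟩
          have h1 := h.1
          rw [sub_eq_add_neg, ← Pi.single_neg] at h1
          exact h1
      choose s hs hsC using hsex
      intro u
      -- Up to a constant, the sum is the distance of `u` from the corner of the cell facing the
      -- occupied neighbours. A step in direction `s i` either enters such a neighbour or decreases
      -- the sum.
      induction h : (∑ i, (2 * s i * z i + 1 - s i * u i)).toNat using Nat.strong_induction_on
        generalizing u with
      | _ n ih =>
        intro hu
        have hside : ∀ i k, (u + Pi.single i (s i), k) ∈ C := by
          intro i k
          have hui := hu i
          by_cases hcell : (u i + s i) / 2 = z i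
          · have hcell' : ∀ j, (u + Pi.single i (s i) : Fin (d - 1) → ℤ) j / 2 = z j := fun j => by
              by_cases hj : j = i
              · subst hj; simpa using hcell
              · simpa [hj] using hu j
            have hnonneg : ∀ v : Fin (d - 1) → ℤ, (∀ j, v j / 2 = z j) →
                ∀ j, 0 ≤ 2 * s j * z j + 1 - s j * v j := fun v hv j => by
              have := hv j
              rcases hs j with h | h <;> rw [h] <;> omega
            refine ih _ ?_ _ rfl hcell' k
            rw [← h]
            have h0 : 0 ≤ ∑ j, (2 * s j * z j + 1 - s j * (u + Pi.single i (s i) : Fin (d - 1) → ℤ) j) :=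
              Finset.sum_nonneg fun j _ => hnonneg _ hcell' j
            have hlt : ∑ j, (2 * s j * z j + 1 - s j * (u + Pi.single i (s i) : Fin (d - 1) → ℤ) j) <
                ∑ j, (2 * s j * z j + 1 - s j * u j) := by
              refine Finset.sum_lt_sum (fun j _ => ?_) ⟨i, Finset.mem_univ i, ?_⟩
              · by_cases hj : j = i
                · subst hj
                  simp only [Pi.add_apply, Pi.single_eq_same]
                  rcases hs j with h | h <;> rw [h] <;> omega
                · simp [hj]
              · simp only [Pi.add_apply, Pi.single_eq_same]
                rcases hs i with h | h <;> rw [h] <;> omega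
            omega
          · refine hsC i _ (fun j => ?_) k
            by_cases hj : j = i
            · subst hj
              simp only [Pi.add_apply, Pi.single_eq_same]
              rcases hs j with h | h <;> rw [h] at hcell ⊢ <;> omega
            · simpa [hj] using hu j
        intro k
        -- Each column is filled upwards from the frozen layer, so the vertex below is always
        -- available.
        induction hk : (k : ℕ) generalizing k with
        | zero => exact hC (Or.inr (Fin.ext hk))
        | succ l ihk =>
          have hk0 : k ≠ 0 := fun h => by rw [h] at hk; simp at hk
          have hdown : ∀ k' : Fin (K + 1), (k' : ℕ) + 1 = k → (u, k') ∈ C :=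
            fun k' hk' => ihk k' (by omega)
          refine hmaj _ (Finset.mem_biUnion.2 ⟨z, hz, mem_slabCell.2 ⟨hu, hk0⟩⟩) ?_
          exact (outDegree_slab_le hs (fun i => hside i k) hdown).trans
            (le_inDegree_slab hk0 hs (fun i => hside i k) hdown)
  rintro ⟨u, k⟩ hx
  obtain ⟨z, hz, hx⟩ := Finset.mem_biUnion.1 (Finset.mem_coe.1 hx)
  exact key hz u (mem_slabCell.1 hx).1 k

end SlabGeometry

/-! ### Events depending on disjoint finite sets of independent variables -/

section Independence

variable {Ω κ β : Type*} [MeasurableSpace β] [MeasurableSingletonClass β]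

theorem measureReal_forall_eq [MeasurableSpace Ω] {P : Measure Ω} {X : κ → Ω → β}
    (hind : iIndepFun X P) (S : Finset κ) (b : β) {p : ℝ} (hp : ∀ i, P.real {ω | X i ω = b} = p) :
    P.real {ω | ∀ i ∈ S, X i ω = b} = p ^ S.card := by
  have h := hind.measure_inter_preimage_eq_mul S (sets := fun _ => {b})
    fun _ _ => measurableSet_singleton b
  have h1 : {ω | ∀ i ∈ S, X i ω = b} = ⋂ i ∈ S, X i ⁻¹' {b} := by
    ext ω; simp
  rw [h1, Measure.real, h, ENNReal.toReal_prod]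
  exact Finset.prod_eq_pow_card fun i _ => hp i

variable [Countable β]

/-- Since `S` is finite and `β` countable with measurable singletons, `S → β` is discrete, so
dependence on `S` alone already gives measurability. -/
theorem DependsOn.exists_preimage_restrict {E : (κ → β) → Prop} {S : Finset κ}
    (hE : DependsOn E ↑S) (X : κ → Ω → β) : ∃ A : Set (S → β), MeasurableSet A ∧
      {ω | E fun i => X i ω} = (fun ω (i : S) => X i ω) ⁻¹' A := by
  refine ⟨{g | ∃ f : κ → β, (∀ i : S, f i = g i) ∧ E f}, MeasurableSet.of_discrete, ?_⟩
  ext ω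
  constructor
  · intro h
    exact ⟨_, fun _ => rfl, h⟩
  · rintro ⟨f, hf, h⟩
    have : E f = E fun i => X i ω := hE fun i hi => hf ⟨i, hi⟩
    exact this.mp h

variable [MeasurableSpace Ω] {P : Measure Ω} {X : κ → Ω → β}

theorem DependsOn.measurableSet_setOf {E : (κ → β) → Prop} {S : Finset κ} (hE : DependsOn E ↑S)
    (hX : ∀ i, Measurable (X i)) : MeasurableSet {ω | E fun i => X i ω} := by
  obtain ⟨A, hA, h⟩ := hE.exists_preimage_restrict X
  rw [h]
  exact (measurable_pi_lambda (fun ω (i : S) => X i ω) fun i => hX i) hA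

/-- Events depending on disjoint finite sets of independent random variables are independent. -/
theorem DependsOn.measure_and {E E' : (κ → β) → Prop} {S T : Finset κ} (hE : DependsOn E ↑S)
    (hE' : DependsOn E' ↑T) (hST : Disjoint S T) (hX : ∀ i, Measurable (X i))
    (hind : iIndepFun X P) :
    P {ω | (E fun i => X i ω) ∧ E' fun i => X i ω} =
      P {ω | E fun i => X i ω} * P {ω | E' fun i => X i ω} := by
  obtain ⟨A, hA, h⟩ := hE.exists_preimage_restrict X
  obtain ⟨A', hA', h'⟩ := hE'.exists_preimage_restrict X
  have := (hind.indepFun_finset S T hST hX).measure_inter_preimage_eq_mul A A' hA hA'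
  rw [← h, ← h'] at this
  exact this

theorem DependsOn.measureReal_and {E E' : (κ → β) → Prop} {S T : Finset κ} (hE : DependsOn E ↑S)
    (hE' : DependsOn E' ↑T) (hST : Disjoint S T) (hX : ∀ i, Measurable (X i))
    (hind : iIndepFun X P) :
    P.real {ω | (E fun i => X i ω) ∧ E' fun i => X i ω} =
      P.real {ω | E fun i => X i ω} * P.real {ω | E' fun i => X i ω} := by
  simp only [Measure.real, ← ENNReal.toReal_mul, hE.measure_and hE' hST hX hind]

/-- The indicators of events depending on disjoint finite sets of independent random variables are
independent. -/
theorem iIndepFun_of_dependsOn [IsProbabilityMeasure P] {γ : Type*} {E : γ → (κ → β) → Prop}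
    {S : γ → Finset κ} (hE : ∀ z, DependsOn (E z) ↑(S z)) (hS : ∀ z z', z ≠ z' → Disjoint (S z) (S z'))
    (hX : ∀ i, Measurable (X i)) (hind : iIndepFun X P) :
    iIndepFun (fun z ω => E z fun i => X i ω) P := by
  classical
  rw [iIndepFun_iff_measure_inter_preimage_eq_mul]
  intro T A _
  induction T using Finset.induction_on with
  | empty => simp
  | insert z T hz ih =>
    rw [Finset.set_biInter_insert, Finset.prod_insert hz, ← ih fun _ _ => .of_discrete]
    have hdep : DependsOn (fun f => E z f ∈ A z) (↑(S z) : Set κ) := fun f g hfg => by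
      simp only [hE z hfg]
    have hdep' : DependsOn (fun f => ∀ y ∈ T, E y f ∈ A y) (↑(T.biUnion S) : Set κ) := by
      intro f g hfg
      refine propext (forall₂_congr fun y hy => ?_)
      rw [hE y fun i hi => hfg i (Finset.mem_coe.2 (Finset.mem_biUnion.2 ⟨y, hy, hi⟩))]
    have hdisj : Disjoint (S z) (T.biUnion S) := by
      rw [Finset.disjoint_biUnion_right]
      exact fun y hy => hS z y fun h => hz (h ▸ hy)
    have hT : (⋂ y ∈ T, (fun ω => E y fun i => X i ω) ⁻¹' A y) =
        {ω | ∀ y ∈ T, (E y fun i => X i ω) ∈ A y} := by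
      ext ω; simp
    rw [hT]
    exact hdep.measure_and hdep' hdisj hX hind

theorem measureReal_forall_lt_not_le [IsProbabilityMeasure P] {E : ℕ → (κ → β) → Prop}
    {S : ℕ → Finset κ} (hE : ∀ j, DependsOn (E j) ↑(S j))
    (hX : ∀ i, Measurable (X i)) (hind : iIndepFun X P) {δ : ℝ} (M : ℕ)
    (hS : ∀ i j, i < j → j < M → Disjoint (S i) (S j))
    (hδ : ∀ j < M, δ ≤ P.real {ω | E j fun i => X i ω}) :
    P.real {ω | ∀ j < M, ¬ E j fun i => X i ω} ≤ (1 - δ) ^ M := by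
  classical
  induction M with
  | zero => simp
  | succ M ih =>
    have ih' := ih (fun i j hij hj => hS i j hij (by omega)) fun j hj => hδ j (by omega)
    have h1 : {ω | ∀ j < M + 1, ¬ E j fun i => X i ω} =
        {ω | (∀ j < M, ¬ E j fun i => X i ω) ∧ ¬ E M fun i => X i ω} := by
      ext ω
      simp only [Set.mem_ofPred_eq, Nat.lt_succ_iff_lt_or_eq]
      exact ⟨fun h => ⟨fun j hj => h j (Or.inl hj), h M (Or.inr rfl)⟩,
        fun h j hj => hj.elim (h.1 j) fun h' => h' ▸ h.2⟩
    have hdep : DependsOn (fun f => ∀ j < M, ¬ E j f) (↑((Finset.range M).biUnion S) : Set κ) := by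
      intro f g hfg
      refine propext (forall₂_congr fun j hj => not_congr (Iff.of_eq (hE j fun i hi => hfg i ?_)))
      exact Finset.mem_coe.2 (Finset.mem_biUnion.2 ⟨j, Finset.mem_range.2 hj, hi⟩)
    have hdep' : DependsOn (fun f => ¬ E M f) (↑(S M) : Set κ) := fun f g hfg => by
      simp only [hE M hfg]
    have hdisj : Disjoint ((Finset.range M).biUnion S) (S M) := by
      rw [Finset.disjoint_biUnion_left]
      exact fun j hj => hS j M (Finset.mem_range.1 hj) (by omega)
    have hcompl : P.real {ω | ¬ E M fun i => X i ω} = 1 - P.real {ω | E M fun i => X i ω} := by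
      rw [← probReal_compl_eq_one_sub ((hE M).measurableSet_setOf hX)]
      rfl
    have hδM := hδ M (by omega)
    rw [h1, hdep.measureReal_and hdep' hdisj hX hind, pow_succ]
    refine mul_le_mul ih' (by rw [hcompl]; linarith) measureReal_nonneg ?_
    have : P.real {ω | E M fun i => X i ω} ≤ 1 := measureReal_le_one
    exact pow_nonneg (by linarith) M

/-- Among infinitely many events which depend on disjoint finite sets of independent random
variables and have probability bounded below, some event occurs almost surely. -/
theorem ae_exists_of_dependsOn [IsProbabilityMeasure P] {E : ℕ → (κ → β) → Prop}
    {S : ℕ → Finset κ} (hE : ∀ j, DependsOn (E j) ↑(S j))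
    (hX : ∀ i, Measurable (X i)) (hind : iIndepFun X P) {δ : ℝ} (hδ0 : 0 < δ)
    (hS : ∀ i j, i < j → Disjoint (S i) (S j))
    (hδ : ∀ j, δ ≤ P.real {ω | E j fun i => X i ω}) :
    ∀ᵐ ω ∂P, ∃ j, E j fun i => X i ω := by
  have hδ1 : δ ≤ 1 := (hδ 0).trans measureReal_le_one
  have hlim : Tendsto (fun M : ℕ => (1 - δ) ^ M) atTop (𝓝 0) :=
    tendsto_pow_atTop_nhds_zero_of_lt_one (by linarith) (by linarith)
  have hle : P.real {ω | ¬ ∃ j, E j fun i => X i ω} ≤ 0 := by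
    refine ge_of_tendsto' hlim fun M => le_trans (measureReal_mono fun ω hω => ?_)
      (measureReal_forall_lt_not_le hE hX hind M (fun i j hij _ => hS i j hij) fun j _ => hδ j)
    intro j _ h
    exact hω ⟨j, h⟩
  rw [ae_iff, ← measureReal_eq_zero_iff]
  exact le_antisymm hle measureReal_nonneg

end Independence

/-! ### Good time windows occur almost surely -/

section Windows

variable {Ω V : Type*} [MeasurableSpace Ω] {P : Measure Ω} [IsProbabilityMeasure P]

/-- Between the times `j L` and `(j + 1) L` every clock in `U` rings exactly once in every unit time
interval. Here `f x k` is the number of rings at `x` up to time `k`. -/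
def RingPattern (U : Finset V) (L : ℕ) (f : V → ℕ → ℕ) (j : ℕ) : Prop :=
  ∀ x ∈ U, ∀ k, j * L ≤ k → k < j * L + L → f x (k + 1) - f x k = 1

theorem RingPattern.apply_add {U : Finset V} {L : ℕ} {f : V → ℕ → ℕ} {j : ℕ}
    (h : RingPattern U L f j) {x : V} (hx : x ∈ U) {l : ℕ} (hl : l ≤ L) :
    f x (j * L + l) = f x (j * L) + l := by
  induction l with
  | zero => rfl
  | succ l ih =>
    have h1 := h x hx (j * L + l) (by omega) (by omega)
    have h2 := ih (by omega)
    rw [← add_assoc]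
    omega

/-- The increments over unit intervals are independent Poisson variables of mean 1, over vertices
and intervals alike. So the blocks succeed independently with the same positive probability, and
some block succeeds beyond every starting index. -/
theorem ae_frequently_ringPattern {N : V → ℝ≥0 → Ω → ℕ}
    (hN : ∀ x, IsPoissonProcess (N x) 1 P) (hind : iIndepFun (fun x ω t => N x t ω) P)
    (U : Finset V) (L : ℕ) :
    ∀ᵐ ω ∂P, ∃ᶠ j in atTop, RingPattern U L (fun x k => N x k ω) j := by
  classical
  set D : V × ℕ → Ω → ℕ := fun p ω => N p.1 ↑(p.2 + 1) ω - N p.1 ↑p.2 ω with hD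
  have hDm : ∀ p, Measurable (D p) := fun p =>
    ((hN p.1).measurable _).sub ((hN p.1).measurable _)
  have hDind : iIndepFun D P := by
    refine iIndepFun_uncurry' (X := fun x (k : ℕ) ω => N x ↑(k + 1) ω - N x ↑k ω)
      (fun x k => hDm (x, k)) ?_ fun x => ?_
    · exact hind.comp (fun _ (f : ℝ≥0 → ℕ) (k : ℕ) => f ↑(k + 1) - f ↑k) fun _ =>
        measurable_pi_lambda _ fun k => (measurable_pi_apply _).sub (measurable_pi_apply _)
    · exact (hN x).indep.nat (t := fun k : ℕ => (k : ℝ≥0)) Nat.mono_cast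
  have hDlaw : ∀ p, P.real {ω | D p ω = 1} = (poissonMeasure 1).real {1} := by
    intro p
    have h1 := (hN p.1).law ↑p.2 ↑(p.2 + 1) (by exact_mod_cast Nat.le_succ p.2)
    have h2 : (1 : ℝ≥0) * (↑(p.2 + 1) - ↑p.2) = 1 := by
      rw [Nat.cast_add, Nat.cast_one, one_mul, add_tsub_cancel_left]
    rw [h2] at h1
    rw [← h1.map_eq, Measure.real, Measure.real, Measure.map_apply (hDm p) (measurableSet_singleton _)]
    rfl
  have hpos : 0 < (poissonMeasure 1).real {1} := poissonMeasure_real_singleton_pos 1 one_pos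
  set S : ℕ → Finset (V × ℕ) := fun j => U ×ˢ Finset.Ico (j * L) (j * L + L) with hS
  have hpat : ∀ j ω, RingPattern U L (fun x k => N x k ω) j ↔ ∀ p ∈ S j, D p ω = 1 := by
    intro j ω
    simp only [RingPattern, hS, Finset.mem_product, Finset.mem_Ico, Prod.forall, hD]
    exact ⟨fun h x k hk => h x hk.1 k hk.2.1 hk.2.2, fun h x hx k h1 h2 => h x k ⟨hx, h1, h2⟩⟩
  have hcard : ∀ j, (S j).card = U.card * L := fun j => by simp [hS]
  have key : ∀ j₀, ∀ᵐ ω ∂P, ∃ j, RingPattern U L (fun x k => N x k ω) (j₀ + j) := by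
    intro j₀
    have := ae_exists_of_dependsOn (P := P) (X := D)
      (E := fun j f => ∀ p ∈ S (j₀ + j), f p = 1) (S := fun j => S (j₀ + j))
      (δ := (poissonMeasure 1).real {1} ^ (U.card * L)) ?_ hDm hDind (pow_pos hpos _) ?_ ?_
    · filter_upwards [this] with ω hω
      obtain ⟨j, hj⟩ := hω
      exact ⟨j, (hpat _ _).2 hj⟩
    · intro j f g hfg
      exact propext (forall₂_congr fun p hp => by rw [hfg p hp])
    · intro i j hij
      refine Finset.disjoint_product.2 (Or.inr ?_)
      rw [Finset.disjoint_left]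
      intro k hk hk'
      rw [Finset.mem_Ico] at hk hk'
      have : (j₀ + i) * L + L ≤ (j₀ + j) * L := by
        rw [← Nat.succ_mul]; exact Nat.mul_le_mul_right L (by omega)
      omega
    · intro j
      rw [measureReal_forall_eq hDind _ _ hDlaw, hcard]
  filter_upwards [ae_all_iff.2 key] with ω hω
  refine Nat.frequently_atTop_iff_infinite.2 (Set.infinite_of_not_bddAbove ?_)
  rintro ⟨M, hM⟩
  obtain ⟨j, hj⟩ := hω (M + 1)
  have := hM hj
  omega

/-- All coins tossed in `U` between the times `j L` and `(j + 1) L` show `+1`. -/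
def CoinPattern (U : Finset V) (L : ℕ) (f : V → ℕ → ℕ) (e : V → ℕ → ℤˣ) (j : ℕ) : Prop :=
  ∀ x ∈ U, ∀ n, f x (j * L) < n → n ≤ f x (j * L + L) → e x n = 1

instance : MeasurableSingletonClass ℤˣ :=
  ⟨fun a => ⟨{(a : ℤ)}, measurableSet_singleton _, by ext b; simp [Units.ext_iff]⟩⟩

/-- Here the clocks are fixed and only the coins are random. Exactly one ring per unit interval
means that a window uses `L` coins per vertex, so its coins are all `+1` with probability at least
`2 ^ (-|U| L)`; different windows use disjoint sets of coins. -/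
theorem ae_exists_coinPattern {c : V → ℕ → Ω → ℤˣ} (hcm : ∀ x n, Measurable (c x n))
    (hc : ∀ x n, P {ω | c x n ω = 1} = 1 / 2)
    (hind : iIndepFun (fun p : V × ℕ => c p.1 p.2) P) (U : Finset V) {L : ℕ} {f : V → ℕ → ℕ}
    (hf : ∀ x, Monotone (f x)) (hpat : ∃ᶠ j in atTop, RingPattern U L f j) :
    ∀ᵐ ω ∂P, ∃ j, RingPattern U L f j ∧ CoinPattern U L f (fun x n => c x n ω) j := by
  classical
  obtain ⟨φ, hφ, hφpat⟩ := extraction_of_frequently_atTop hpat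
  set S : ℕ → Finset (V × ℕ) := fun j => U.biUnion fun x =>
    {x} ×ˢ Finset.Ioc (f x (φ j * L)) (f x (φ j * L + L)) with hS
  have hmem : ∀ j p, p ∈ S j ↔ p.1 ∈ U ∧ f p.1 (φ j * L) < p.2 ∧ p.2 ≤ f p.1 (φ j * L + L) := by
    intro j p
    simp only [hS, Finset.mem_biUnion, Finset.mem_product, Finset.mem_singleton, Finset.mem_Ioc]
    constructor
    · rintro ⟨x, hx, hpx, h⟩
      rw [hpx]
      exact ⟨hx, h⟩
    · rintro ⟨hx, h⟩
      exact ⟨p.1, hx, rfl, h⟩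
  have hcard : ∀ j, (S j).card ≤ U.card * L := by
    intro j
    refine Finset.card_biUnion_le_card_mul _ _ _ fun x hx => ?_
    rw [Finset.card_product, (hφpat j).apply_add hx le_rfl]
    simp
  have hlaw : ∀ p : V × ℕ, P.real {ω | c p.1 p.2 ω = 1} = 1 / 2 := fun p => by
    rw [Measure.real, hc]; simp
  have := ae_exists_of_dependsOn (P := P) (X := fun p : V × ℕ => c p.1 p.2)
    (E := fun j f => ∀ p ∈ S j, f p = 1) (S := S) (δ := (1 / 2) ^ (U.card * L))
    ?_ (fun p => hcm p.1 p.2) hind (by positivity) ?_ ?_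
  · filter_upwards [this] with ω hω
    obtain ⟨j, hj⟩ := hω
    exact ⟨φ j, hφpat j, fun x hx n h1 h2 => hj (x, n) ((hmem j _).2 ⟨hx, h1, h2⟩)⟩
  · intro j f g hfg
    exact propext (forall₂_congr fun p hp => by rw [hfg p hp])
  · intro i j hij
    rw [Finset.disjoint_left]
    intro p hp hp'
    rw [hmem] at hp hp'
    have h1 : φ i * L + L ≤ φ j * L := by
      rw [← Nat.succ_mul]; exact Nat.mul_le_mul_right L (hφ hij)
    have := hf p.1 h1
    omega
  · intro j
    rw [measureReal_forall_eq (X := fun p : V × ℕ => c p.1 p.2) hind _ _ hlaw]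
    exact pow_le_pow_of_le_one (by norm_num) (by norm_num) (hcard j)

theorem measurableSet_patterns [Countable V] (U : Finset V) (L : ℕ) :
    MeasurableSet {p : (V → ℕ → ℕ) × (V → ℕ → ℤˣ) | (∀ x, Monotone (p.1 x)) ∧
      (∃ᶠ j in atTop, RingPattern U L p.1 j) ∧
      ¬ ∃ j, RingPattern U L p.1 j ∧ CoinPattern U L p.1 p.2 j} := by
  have hf : ∀ x k, Measurable fun p : (V → ℕ → ℕ) × (V → ℕ → ℤˣ) => p.1 x k := fun x k => by
    fun_prop
  have he : ∀ x k, Measurable fun p : (V → ℕ → ℕ) × (V → ℕ → ℤˣ) => p.2 x k := fun x k => by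
    fun_prop
  have hprop : ∀ {α : Type _} [MeasurableSpace α] {q : α → Prop}, MeasurableSet {a | q a} →
      Measurable q := fun h => measurable_to_prop (by simpa [Set.preimage] using h)
  have hring : ∀ j, Measurable fun p : (V → ℕ → ℕ) × (V → ℕ → ℤˣ) => RingPattern U L p.1 j := by
    intro j
    refine Measurable.forall fun x => Measurable.imp measurable_const ?_
    refine Measurable.forall fun k => Measurable.imp measurable_const (Measurable.imp measurable_const ?_)
    exact hprop (measurableSet_eq_fun ((hf _ _).sub (hf _ _)) measurable_const)
  have hcoin : ∀ j, Measurable fun p : (V → ℕ → ℕ) × (V → ℕ → ℤˣ) =>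
      CoinPattern U L p.1 p.2 j := by
    intro j
    refine Measurable.forall fun x => Measurable.imp measurable_const ?_
    refine Measurable.forall fun n => Measurable.imp ?_ (Measurable.imp ?_ ?_)
    · exact hprop (measurableSet_lt (hf _ _) measurable_const)
    · exact hprop (measurableSet_le measurable_const (hf _ _))
    · exact hprop ((he x n) (measurableSet_singleton 1))
  simp only [Filter.frequently_atTop]
  refine measurableSet_setOfPred.2 (Measurable.and ?_ (Measurable.and ?_ ?_))
  · refine Measurable.forall fun x => Measurable.forall fun k => Measurable.forall fun l =>
      Measurable.imp measurable_const ?_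
    exact hprop (measurableSet_le (hf _ _) (hf _ _))
  · exact Measurable.forall fun a => Measurable.exists fun b => measurable_const.and (hring b)
  · exact (Measurable.exists fun j => (hring j).and (hcoin j)).not

/-- Which coins a window uses is random, so one conditions on the clocks: by independence the joint
law is a product, and Fubini reduces to fixed clocks. -/
theorem ae_exists_isGoodWindow [Countable V] {N : V → ℝ≥0 → Ω → ℕ}
    (hN : ∀ x, IsPoissonProcess (N x) 1 P) (hind : iIndepFun (fun x ω t => N x t ω) P)
    {c : V → ℕ → Ω → ℤˣ} (hcm : ∀ x n, Measurable (c x n))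
    (hc : ∀ x n, P {ω | c x n ω = 1} = 1 / 2)
    (hcind : iIndepFun (fun p : V × ℕ => c p.1 p.2) P)
    (hNc : IndepFun (fun ω x t => N x t ω) (fun ω x n => c x n ω) P) (U : Finset V) :
    ∀ᵐ ω ∂P, ∃ r, IsGoodWindow U (fun x t => N x t ω) (fun x n => c x n ω) r := by
  -- Only integer times matter for the patterns, leaving countably many coordinates and measurable
  -- events.
  set f : Ω → V → ℕ → ℕ := fun ω x k => N x k ω with hf
  set e : Ω → V → ℕ → ℤˣ := fun ω x n => c x n ω with he
  have hfm : Measurable f := measurable_pi_lambda _ fun x => measurable_pi_lambda _ fun k =>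
    (hN x).measurable k
  have hem : Measurable e := measurable_pi_lambda _ fun x => measurable_pi_lambda _ fun n => hcm x n
  have hfe : IndepFun f e P :=
    hNc.comp (φ := fun (g : V → ℝ≥0 → ℕ) x (k : ℕ) => g x k) (ψ := id) (by fun_prop) measurable_id
  set L := U.card + 1 with hL
  have hmeas := measurableSet_patterns U L
  have hnull : P {ω | (f ω, e ω) ∈ {p : (V → ℕ → ℕ) × (V → ℕ → ℤˣ) |
      (∀ x, Monotone (p.1 x)) ∧ (∃ᶠ j in atTop, RingPattern U L p.1 j) ∧
      ¬ ∃ j, RingPattern U L p.1 j ∧ CoinPattern U L p.1 p.2 j}} = 0 := by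
    have hprod := (indepFun_iff_map_prod_eq_prod_map_map hfm.aemeasurable hem.aemeasurable).1 hfe
    have := Measure.isProbabilityMeasure_map (μ := P) hem.aemeasurable
    have h1 := Measure.map_apply (μ := P) (hfm.prodMk hem) hmeas
    refine h1.symm.trans ?_
    rw [hprod, Measure.measure_prod_null hmeas]
    refine Eventually.of_forall fun g => ?_
    simp only [Pi.zero_apply]
    rw [Measure.map_apply hem (measurable_prodMk_left hmeas)]
    by_cases hg : (∀ x, Monotone (g x)) ∧ ∃ᶠ j in atTop, RingPattern U L g j
    · refine measure_mono_null ?_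
        (ae_iff.1 (ae_exists_coinPattern hcm hc hcind U hg.1 hg.2))
      exact fun ω hω => hω.2.2
    · convert measure_empty (μ := P)
      ext ω
      simp only [Set.mem_preimage, Set.mem_empty_iff_false, iff_false]
      exact fun hω => hg ⟨hω.1, hω.2.1⟩
  have hmono : ∀ᵐ ω ∂P, ∀ x, Monotone fun t => N x t ω := ae_all_iff.2 fun x => (hN x).mono
  filter_upwards [hmono, ae_frequently_ringPattern hN hind U L,
    measure_eq_zero_iff_ae_notMem.1 hnull] with ω h1 h2 h3
  have h4 : ∃ j, RingPattern U L (f ω) j ∧ CoinPattern U L (f ω) (e ω) j := by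
    by_contra h
    exact h3 ⟨fun x k l hkl => h1 x (by exact_mod_cast hkl), h2, h⟩
  obtain ⟨j, hj, hj'⟩ := h4
  refine ⟨j * L, fun x hx k hk => ?_, fun x hx n hn hn' => hj' x hx n hn hn'⟩
  have : N x ↑(j * L + k + 1) ω - N x ↑(j * L + k) ω = 1 :=
    hj x hx (j * L + k) (by omega) (by omega)
  dsimp only
  omega

end Windows

/-! ### Random bootstrap percolation: induction on the dimension -/

section RandomBootstrap

variable {ι : Type*} [DecidableEq ι]

theorem self_mem_axisCube (a : ι → ℤ) (I : Finset ι) (n : ℕ) : a ∈ axisCube a I n := by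
  rw [mem_axisCube]
  intro i
  split_ifs <;> omega

theorem axisCube_mono (a : ι → ℤ) (I : Finset ι) {l n : ℕ} (h : l ≤ n) :
    axisCube a I l ⊆ axisCube a I n := by
  intro x hx
  rw [mem_axisCube] at hx ⊢
  intro i
  have := hx i
  split_ifs at this ⊢ <;> omega

theorem dependsOn_isSpanned (I : Finset ι) (B : Set (ι → ℤ)) :
    DependsOn (fun f : (ι → ℤ) → Prop => IsSpanned I {z | f z} B) B := by
  intro f g hfg
  refine propext ⟨fun h => h.congr ?_, fun h => h.congr ?_⟩
  · rintro z ⟨hz, hzB⟩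
    exact (hfg z hzB).mp hz
  · rintro z ⟨hz, hzB⟩
    exact (hfg z hzB).mpr hz

variable {Ω : Type*} [MeasurableSpace Ω] {P : Measure Ω}
  {Y : (ι → ℤ) → Ω → Prop}

theorem measureReal_exists_face_le {I : Finset ι} (Q : Finset (ι → ℤ)) {l : ℕ} {b : ℝ}
    (hb : ∀ i ∈ I, ∀ y,
      P.real {ω | ¬ IsSpanned (I.erase i) {z | Y z ω} (axisCube y (I.erase i) l)} ≤ b) :
    P.real {ω | ∃ i ∈ I, ∃ y ∈ Q,
      ¬ IsSpanned (I.erase i) {z | Y z ω} (axisCube y (I.erase i) l)} ≤ I.card * (Q.card * b) := by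
  have h : {ω | ∃ i ∈ I, ∃ y ∈ Q,
      ¬ IsSpanned (I.erase i) {z | Y z ω} (axisCube y (I.erase i) l)} =
      ⋃ i ∈ I, ⋃ y ∈ Q,
        {ω | ¬ IsSpanned (I.erase i) {z | Y z ω} (axisCube y (I.erase i) l)} := by
    ext ω
    simp
  rw [h]
  refine (measureReal_biUnion_finset_le _ _).trans ?_
  rw [← nsmul_eq_mul]
  refine Finset.sum_le_card_nsmul _ _ _ fun i hi => ?_
  refine (measureReal_biUnion_finset_le _ _).trans ?_
  rw [← nsmul_eq_mul]
  exact Finset.sum_le_card_nsmul _ _ _ fun y _ => hb i hi y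

/-- The probability that a cube is not internally spanned decays faster than any power. -/
def SpanningFailureDecays (P : Measure Ω) (Y : (ι → ℤ) → Ω → Prop) (I : Finset ι) : Prop :=
  ∀ q : ℕ, ∃ C : ℝ, ∀ (n : ℕ) (a : ι → ℤ),
    P.real {ω | ¬ IsSpanned I {z | Y z ω} (axisCube a I n)} * ((n : ℝ) + 1) ^ q ≤ C

theorem exists_uniform_bound {I : Finset ι}
    (hface : ∀ i ∈ I, SpanningFailureDecays P Y (I.erase i)) (q : ℕ) :
    ∃ C : ℝ, 0 ≤ C ∧ ∀ i ∈ I, ∀ (n : ℕ) (a : ι → ℤ),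
      P.real {ω | ¬ IsSpanned (I.erase i) {z | Y z ω} (axisCube a (I.erase i) n)} ≤
        C / ((n : ℝ) + 1) ^ q := by
  choose! C hC using fun i (hi : i ∈ I) => hface i hi q
  have hC0 : ∀ i ∈ I, 0 ≤ C i := fun i hi => le_trans (by positivity) (hC i hi 0 0)
  refine ⟨∑ i ∈ I, C i, Finset.sum_nonneg hC0, fun i hi n a => ?_⟩
  rw [le_div_iff₀ (by positivity)]
  exact (hC i hi n a).trans (Finset.single_le_sum hC0 hi)

variable [Fintype ι]

/-- `axisCube` as a finite set. -/
noncomputable def axisCubeFinset (a : ι → ℤ) (I : Finset ι) (n : ℕ) : Finset (ι → ℤ) :=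
  Finset.Icc a (fun i => if i ∈ I then a i + n else a i)

theorem coe_axisCubeFinset (a : ι → ℤ) (I : Finset ι) (n : ℕ) :
    (axisCubeFinset a I n : Set (ι → ℤ)) = axisCube a I n :=
  Finset.coe_Icc _ _

theorem mem_axisCubeFinset {a x : ι → ℤ} {I : Finset ι} {n : ℕ} :
    x ∈ axisCubeFinset a I n ↔ ∀ i, a i ≤ x i ∧ x i ≤ if i ∈ I then a i + n else a i := by
  rw [← Finset.mem_coe, coe_axisCubeFinset, mem_axisCube]

theorem card_axisCubeFinset_le (a : ι → ℤ) (I : Finset ι) (n : ℕ) :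
    (axisCubeFinset a I n).card ≤ (n + 1) ^ Fintype.card ι := by
  rw [axisCubeFinset, Pi.card_Icc]
  refine (Finset.prod_le_pow_card _ _ (n + 1) fun i _ => ?_)
  rw [Int.card_Icc]
  split_ifs <;> omega

theorem IsSpanned.axisCube_succ {a : ι → ℤ} {I : Finset ι} {O : Set (ι → ℤ)} {l : ℕ}
    (h : IsSpanned I O (axisCube a I l))
    (hface : ∀ i ∈ I, ∀ y, axisCube y (I.erase i) l ⊆ axisCube a I (l + 1) →
      (y i < a i ∨ a i + l < y i) → IsSpanned (I.erase i) O (axisCube y (I.erase i) l)) :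
    IsSpanned I O (axisCube a I (l + 1)) := by
  refine h.grow (l := l) le_rfl (Pi.le_def.2 fun i => ?_) (fun i hi => by simp [hi])
    (fun i hi => by simp [hi]) (Pi.le_def.2 fun i => ?_) fun i hi y hy hyi => ?_
  · split_ifs <;> push_cast <;> omega
  · split_ifs <;> omega
  · exact hface i hi y hy (by simpa [hi] using hyi)

theorem IsSpanned.axisCube_of_subcube {a b : ι → ℤ} {I : Finset ι} {O : Set (ι → ℤ)} {l n : ℕ}
    (h : IsSpanned I O (axisCube b I l)) (hsub : axisCube b I l ⊆ axisCube a I n)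
    (hface : ∀ i ∈ I, ∀ y ∈ axisCube a I n, IsSpanned (I.erase i) O (axisCube y (I.erase i) l)) :
    IsSpanned I O (axisCube a I n) := by
  have h1 := hsub (self_mem_axisCube b I l)
  have h2 : (fun i => if i ∈ I then b i + l else b i) ∈ axisCube b I l := by
    rw [mem_axisCube]
    intro i
    split_ifs <;> omega
  refine h.grow (l := l) h1.1 (hsub h2).2 (fun i hi => by simp [hi])
    (fun i hi => by simp [hi]) (Pi.le_def.2 fun i => ?_) fun i hi y hy _ => ?_
  · split_ifs <;> omega
  · exact hface i hi y (hy (self_mem_axisCube _ _ _))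

/-- A union bound over scales and faces: at scale `l` at most a multiple of `(l + 1) ^ m` faces
occur, each failing with probability at most `C / (l + 1) ^ (m + 2)`. The resulting sum over `l ≥ L`
is at most `D / L`, below `1 / 2` by the choice of `L`. -/
theorem measureReal_exists_scale_le {I : Finset ι}
    (hface : ∀ i ∈ I, SpanningFailureDecays P Y (I.erase i)) :
    ∃ L : ℕ, ∀ (n : ℕ) (a : ι → ℤ), P.real {ω | ∃ l ∈ Finset.Ico L n, ∃ i ∈ I,
      ∃ y ∈ axisCubeFinset a I (l + 1),
        ¬ IsSpanned (I.erase i) {z | Y z ω} (axisCube y (I.erase i) l)} ≤ 1 / 2 := by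
  set m := Fintype.card ι with hm
  obtain ⟨C, hC0, hC⟩ := exists_uniform_bound hface (m + 2)
  set D : ℝ := I.card * (2 ^ m * C) with hD
  have hD0 : 0 ≤ D := by positivity
  obtain ⟨L, hL⟩ := exists_nat_gt (2 * D)
  have hL0 : (0 : ℝ) < L := lt_of_le_of_lt (by positivity) hL
  refine ⟨L, fun n a => ?_⟩
  have hscale : ∀ l : ℕ, P.real {ω | ∃ i ∈ I, ∃ y ∈ axisCubeFinset a I (l + 1),
      ¬ IsSpanned (I.erase i) {z | Y z ω} (axisCube y (I.erase i) l)} ≤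
        D * (((l + 1 : ℕ) : ℝ) ^ 2)⁻¹ := by
    intro l
    refine (measureReal_exists_face_le _ fun i hi y => hC i hi l y).trans ?_
    have h1 : ((axisCubeFinset a I (l + 1)).card : ℝ) ≤ 2 ^ m * ((l : ℝ) + 1) ^ m := by
      have h2 : ((axisCubeFinset a I (l + 1)).card : ℝ) ≤ ((l : ℝ) + 1 + 1) ^ m := by
        exact_mod_cast card_axisCubeFinset_le a I (l + 1)
      refine h2.trans ?_
      rw [← mul_pow]
      refine pow_le_pow_left₀ (by positivity) ?_ m
      have : (0 : ℝ) ≤ l := Nat.cast_nonneg l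
      linarith
    have h3 : (0 : ℝ) < (l : ℝ) + 1 := by positivity
    calc (I.card : ℝ) * ((axisCubeFinset a I (l + 1)).card * (C / ((l : ℝ) + 1) ^ (m + 2)))
        ≤ I.card * (2 ^ m * ((l : ℝ) + 1) ^ m * (C / ((l : ℝ) + 1) ^ (m + 2))) := by gcongr
      _ = D * (((l + 1 : ℕ) : ℝ) ^ 2)⁻¹ := by
        rw [hD, pow_add]; push_cast; field_simp
  have hunion : {ω | ∃ l ∈ Finset.Ico L n, ∃ i ∈ I, ∃ y ∈ axisCubeFinset a I (l + 1),
        ¬ IsSpanned (I.erase i) {z | Y z ω} (axisCube y (I.erase i) l)} =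
      ⋃ l ∈ Finset.Ico L n, {ω | ∃ i ∈ I, ∃ y ∈ axisCubeFinset a I (l + 1),
        ¬ IsSpanned (I.erase i) {z | Y z ω} (axisCube y (I.erase i) l)} := by
    ext ω
    simp only [Set.mem_iUnion, Set.mem_ofPred_eq, exists_prop]
  rw [hunion]
  refine (measureReal_biUnion_finset_le _ _).trans ((Finset.sum_le_sum fun l _ => hscale l).trans ?_)
  rw [← Finset.mul_sum]
  rcases le_or_gt n L with hn | hn
  · rw [Finset.Ico_eq_empty_of_le hn]; simp
  have hsum : ∑ l ∈ Finset.Ico L n, (((l + 1 : ℕ) : ℝ) ^ 2)⁻¹ ≤ (L : ℝ)⁻¹ := by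
    have h1 := sum_Ioc_inv_sq_le_sub (α := ℝ) (k := L) (n := n)
      (by rintro rfl; simp at hL0) hn.le
    have h2 : ∑ l ∈ Finset.Ico L n, (((l + 1 : ℕ) : ℝ) ^ 2)⁻¹ =
        ∑ l ∈ Finset.Ioc L n, ((l : ℝ) ^ 2)⁻¹ := by
      rw [Finset.sum_Ico_add' (fun l : ℕ => ((l : ℝ) ^ 2)⁻¹) L n 1]
      refine Finset.sum_congr ?_ fun _ _ => rfl
      ext l
      simp only [Finset.mem_Ico, Finset.mem_Ioc]
      omega
    rw [h2]
    have : (0 : ℝ) ≤ (n : ℝ)⁻¹ := by positivity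
    linarith
  calc D * ∑ l ∈ Finset.Ico L n, (((l + 1 : ℕ) : ℝ) ^ 2)⁻¹ ≤ D * (L : ℝ)⁻¹ := by gcongr
    _ ≤ 1 / 2 := by
      rw [← div_eq_mul_inv, div_le_iff₀ hL0]
      linarith

variable [IsProbabilityMeasure P]

/-- If faces are spanned with high probability, cubes are spanned with a probability bounded
below. -/
theorem exists_le_measureReal_isSpanned (hY : ∀ z, Measurable (Y z)) (hind : iIndepFun Y P) {p : ℝ}
    (hp0 : 0 < p) (hp : ∀ z, P.real {ω | Y z ω = True} = p) {I : Finset ι}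
    (hface : ∀ i ∈ I, SpanningFailureDecays P Y (I.erase i)) :
    ∃ δ : ℝ, 0 < δ ∧ ∀ (n : ℕ) (a : ι → ℤ),
      δ ≤ P.real {ω | IsSpanned I {z | Y z ω} (axisCube a I n)} := by
  obtain ⟨L, hL⟩ := measureReal_exists_scale_le hface
  have hp1 : p ≤ 1 := by rw [← hp 0]; exact measureReal_le_one
  set δ := p ^ ((L + 1) ^ Fintype.card ι) with hδ
  have hδ0 : 0 < δ := pow_pos hp0 _
  have hfull : ∀ n ≤ L, ∀ a, δ ≤ P.real {ω | ∀ z ∈ axisCubeFinset a I n, Y z ω = True} := by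
    intro n hn a
    rw [measureReal_forall_eq hind _ _ hp]
    refine pow_le_pow_of_le_one hp0.le hp1 ((card_axisCubeFinset_le a I n).trans ?_)
    exact Nat.pow_le_pow_left (by omega) _
  have hspan : ∀ n a ω, (∀ z ∈ axisCubeFinset a I n, Y z ω = True) →
      IsSpanned I {z | Y z ω} (axisCube a I n) := by
    intro n a ω h
    refine IsSpanned.of_subset fun z hz => ?_
    rw [← coe_axisCubeFinset] at hz
    exact of_eq_true (h z hz)
  refine ⟨δ / 2, by positivity, fun n a => ?_⟩
  rcases le_or_gt n L with hn | hn
  · refine le_trans (by linarith) ((hfull n hn a).trans (measureReal_mono fun ω h => ?_))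
    exact hspan n a ω h
  set T := axisCubeFinset a I n \ axisCubeFinset a I L with hT
  -- `E₁` is a fully occupied seed cube and `E₂` allows it to grow scale by scale. The faces in `E₂`
  -- avoid the seed, so the two events are independent.
  set E₁ : ((ι → ℤ) → Prop) → Prop := fun f => ∀ z ∈ axisCubeFinset a I L, f z = True with hE₁
  set E₂ : ((ι → ℤ) → Prop) → Prop := fun f => ∀ l ∈ Finset.Ico L n, ∀ i ∈ I, ∀ y,
    axisCube y (I.erase i) l ⊆ axisCube a I (l + 1) → (y i < a i ∨ a i + l < y i) →
      IsSpanned (I.erase i) {z | f z} (axisCube y (I.erase i) l) with hE₂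
  have hdep₁ : DependsOn E₁ (↑(axisCubeFinset a I L) : Set (ι → ℤ)) := fun f g hfg =>
    propext (forall₂_congr fun z hz => by rw [hfg z hz])
  have hdep₂ : DependsOn E₂ (↑T : Set (ι → ℤ)) := by
    intro f g hfg
    refine propext (forall₂_congr fun l hl => forall₂_congr fun i hi => forall_congr' fun y =>
      forall₂_congr fun hy hyi => Iff.of_eq (dependsOn_isSpanned _ _ fun z hz => hfg z ?_))
    rw [Finset.mem_Ico] at hl
    rw [hT, Finset.coe_sdiff, coe_axisCubeFinset, coe_axisCubeFinset]
    refine ⟨axisCube_mono a I hl.2 (hy hz), fun hzL => ?_⟩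
    have h1 := (mem_axisCube.1 hz) i
    have h2 := (mem_axisCube.1 hzL) i
    simp only [Finset.mem_erase, ne_eq, not_true_eq_false, false_and, if_false] at h1
    rw [if_pos hi] at h2
    omega
  have hprod := hdep₁.measureReal_and hdep₂ Finset.disjoint_sdiff hY hind
  have hE₂half : 1 / 2 ≤ P.real {ω | E₂ fun z => Y z ω} := by
    have hcompl := probReal_compl_eq_one_sub (μ := P) (hdep₂.measurableSet_setOf hY)
    have : P.real {ω | E₂ fun z => Y z ω}ᶜ ≤ 1 / 2 := by
      refine (measureReal_mono fun ω hω => ?_).trans (hL n a)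
      have hω' : ¬ E₂ fun z => Y z ω := hω
      simp only [hE₂] at hω'
      push Not at hω'
      obtain ⟨l, hl, i, hi, y, hy, -, hns⟩ := hω'
      refine ⟨l, hl, i, hi, y, ?_, hns⟩
      rw [← Finset.mem_coe, coe_axisCubeFinset]
      exact hy (self_mem_axisCube _ _ _)
    linarith
  have hsub : {ω | (E₁ fun z => Y z ω) ∧ E₂ fun z => Y z ω} ⊆
      {ω | IsSpanned I {z | Y z ω} (axisCube a I n)} := by
    rintro ω ⟨h₁, h₂⟩
    suffices ∀ l, L ≤ l → l ≤ n → IsSpanned I {z | Y z ω} (axisCube a I l) from this n hn.le le_rfl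
    intro l hLl
    induction l, hLl using Nat.le_induction with
    | base => exact fun _ => hspan L a ω h₁
    | succ l hLl ih =>
      intro hln
      exact (ih (by omega)).axisCube_succ fun i hi y hy hyi =>
        h₂ l (Finset.mem_Ico.2 ⟨hLl, by omega⟩) i hi y hy hyi
  refine le_trans ?_ (measureReal_mono hsub)
  rw [hprod]
  calc δ / 2 = δ * (1 / 2) := by ring
    _ ≤ _ := mul_le_mul (hfull L le_rfl a) hE₂half (by norm_num) measureReal_nonneg

/-- About `√n` disjoint cubes of side about `√n` fit in a row. All of them fail to be spanned only
with probability exponentially small in `√n`, and one spanned cube fills the large one if all faces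
of that side are spanned. -/
theorem SpanningFailureDecays.of_faces (hY : ∀ z, Measurable (Y z)) (hind : iIndepFun Y P) {p : ℝ}
    (hp0 : 0 < p) (hp : ∀ z, P.real {ω | Y z ω = True} = p) {I : Finset ι} (hI : I.Nonempty)
    (hface : ∀ i ∈ I, SpanningFailureDecays P Y (I.erase i)) : SpanningFailureDecays P Y I := by
  obtain ⟨δ, hδ0, hδ⟩ := exists_le_measureReal_isSpanned hY hind hp0 hp hface
  have hδ1 : δ ≤ 1 := (hδ 0 0).trans measureReal_le_one
  obtain ⟨i₀, hi₀⟩ := hI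
  intro q
  set m := Fintype.card ι with hm
  -- Since `n + 1 ≤ 4 R ^ 2` with `R = r + 1`, the exponent `2 m` absorbs the number of faces and `2
  -- q` the factor `(n + 1) ^ q`.
  obtain ⟨C, hC0, hC⟩ := exists_uniform_bound hface (2 * (m + q))
  obtain ⟨B, hB⟩ := (tendsto_pow_const_mul_const_pow_of_abs_lt_one (2 * q) (r := 1 - δ)
    (by rw [abs_lt]; constructor <;> linarith)).bddAbove_range
  refine ⟨4 ^ q * B + I.card * (4 ^ (m + q) * C), fun n a => ?_⟩
  obtain ⟨r, hr1, hr2⟩ : ∃ r : ℕ, (r + 1) * (r + 1) ≤ n + 1 ∧ n + 1 ≤ 4 * ((r + 1) * (r + 1)) := by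
    obtain ⟨r, hr⟩ : ∃ r, Nat.sqrt (n + 1) = r + 1 :=
      Nat.exists_eq_succ_of_ne_zero (Nat.sqrt_pos.2 (Nat.succ_pos n)).ne'
    refine ⟨r, ?_, ?_⟩
    · have := Nat.sqrt_le (n + 1)
      rwa [hr] at this
    · have := Nat.sqrt_lt' (m := n + 1) (n := r + 2) |>.1 (by omega)
      nlinarith
  -- `r + 1` disjoint cubes with side `r + 1` in a row
  set b : ℕ → ι → ℤ := fun j => a + Pi.single i₀ ((j : ℤ) * (r + 1)) with hb
  have hbi : ∀ j, b j i₀ = a i₀ + j * (r + 1) := fun j => by simp [hb]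
  have hbk : ∀ j k, k ≠ i₀ → b j k = a k := fun j k hk => by simp [hb, hk]
  have hsub : ∀ j < r + 1, axisCube (b j) I r ⊆ axisCube a I n := by
    intro j hj x hx
    rw [mem_axisCube] at hx ⊢
    intro k
    have hxk := hx k
    have hjr : (j + 1) * (r + 1) ≤ (r + 1) * (r + 1) := Nat.mul_le_mul_right _ hj
    have hjr' : (j : ℤ) * (r + 1) + (r + 1) ≤ n + 1 := by
      have : ((j : ℤ) + 1) * (r + 1) ≤ n + 1 := by exact_mod_cast hjr.trans hr1
      linarith
    have hj0 : (0 : ℤ) ≤ (j : ℤ) * (r + 1) := by positivity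
    by_cases hk : k = i₀
    · subst hk
      rw [hbi, if_pos hi₀] at hxk
      rw [if_pos hi₀]
      omega
    · rw [hbk j k hk] at hxk
      split_ifs at hxk ⊢ <;> omega
  have hrow : P.real {ω | ∀ j < r + 1, ¬ IsSpanned I {z | Y z ω} (axisCube (b j) I r)} ≤
      (1 - δ) ^ (r + 1) := by
    refine measureReal_forall_lt_not_le
      (E := fun j f => IsSpanned I {z | f z} (axisCube (b j) I r))
      (S := fun j => axisCubeFinset (b j) I r) (fun j => ?_) hY hind (r + 1) ?_
      fun j _ => hδ r (b j)
    · rw [coe_axisCubeFinset]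
      exact dependsOn_isSpanned _ _
    · intro j j' hjj' _
      rw [Finset.disjoint_left]
      intro x hx hx'
      have h1 := mem_axisCubeFinset.1 hx i₀
      have h2 := mem_axisCubeFinset.1 hx' i₀
      rw [hbi, if_pos hi₀] at h1 h2
      have h3 : ((j : ℤ) + 1) * (r + 1) ≤ j' * (r + 1) :=
        mul_le_mul_of_nonneg_right (by exact_mod_cast hjj') (by positivity)
      linarith
  have hbad : P.real {ω | ∃ i ∈ I, ∃ y ∈ axisCubeFinset a I n,
      ¬ IsSpanned (I.erase i) {z | Y z ω} (axisCube y (I.erase i) r)} ≤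
        I.card * ((axisCubeFinset a I n).card * (C / ((r : ℝ) + 1) ^ (2 * (m + q)))) :=
    measureReal_exists_face_le _ fun i hi y => hC i hi r y
  have hle : P.real {ω | ¬ IsSpanned I {z | Y z ω} (axisCube a I n)} ≤ (1 - δ) ^ (r + 1) +
      I.card * ((axisCubeFinset a I n).card * (C / ((r : ℝ) + 1) ^ (2 * (m + q)))) := by
    refine le_trans ?_ (add_le_add hrow hbad)
    refine (measureReal_mono fun ω hω => ?_).trans (measureReal_union_le _ _)
    by_contra hω'
    simp only [Set.mem_union, Set.mem_ofPred_eq, not_or, not_forall, not_exists, not_and,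
      not_not] at hω'
    obtain ⟨⟨j, hj, hsp⟩, hfaces⟩ := hω'
    refine hω (hsp.axisCube_of_subcube (hsub j hj) fun i hi y hy => hfaces i hi y ?_)
    rwa [← Finset.mem_coe, coe_axisCubeFinset]
  set R : ℝ := (r : ℝ) + 1 with hR
  have hR0 : 0 < R := by positivity
  have hnR : (n : ℝ) + 1 ≤ 4 * R ^ 2 := by
    rw [sq, hR]; exact_mod_cast hr2
  have hcard : ((axisCubeFinset a I n).card : ℝ) ≤ (4 * R ^ 2) ^ m := by
    have h1 : ((axisCubeFinset a I n).card : ℝ) ≤ ((n : ℝ) + 1) ^ m := by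
      exact_mod_cast card_axisCubeFinset_le a I n
    exact h1.trans (pow_le_pow_left₀ (by positivity) hnR m)
  have hBR : R ^ (2 * q) * (1 - δ) ^ (r + 1) ≤ B := by
    have := hB ⟨r + 1, rfl⟩
    push_cast at this
    exact this
  have hδ' : 0 ≤ 1 - δ := by linarith
  calc P.real {ω | ¬ IsSpanned I {z | Y z ω} (axisCube a I n)} * ((n : ℝ) + 1) ^ q
      ≤ ((1 - δ) ^ (r + 1) + I.card * ((4 * R ^ 2) ^ m * (C / R ^ (2 * (m + q))))) *
          (4 * R ^ 2) ^ q := by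
        refine mul_le_mul (hle.trans ?_) (pow_le_pow_left₀ (by positivity) hnR q) (by positivity)
          (by positivity)
        gcongr
    _ = 4 ^ q * (R ^ (2 * q) * (1 - δ) ^ (r + 1)) + I.card * (4 ^ (m + q) * C) := by
        have h1 : R ^ (2 * (m + q)) = (R ^ 2) ^ m * (R ^ 2) ^ q := by
          rw [pow_mul, pow_add]
        rw [h1, pow_mul R 2 q, mul_pow, mul_pow, pow_add 4]
        field_simp
    _ ≤ _ := by gcongr

/-- In modified bootstrap percolation with any positive initial density, large cubes are internally
spanned with high probability. -/
theorem spanningFailureDecays (hY : ∀ z, Measurable (Y z)) (hind : iIndepFun Y P) {p : ℝ}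
    (hp0 : 0 < p) (hp : ∀ z, P.real {ω | Y z ω = True} = p) (I : Finset ι) :
    SpanningFailureDecays P Y I := by
  induction I using Finset.strongInduction with
  | H I ih =>
    rcases I.eq_empty_or_nonempty with rfl | hI
    · refine fun q => ⟨0, fun n a => ?_⟩
      simp [isSpanned_empty]
    · exact .of_faces hY hind hp0 hp hI fun i hi => ih _ (Finset.erase_ssubset hi)

theorem ae_exists_isSpanned (hY : ∀ z, Measurable (Y z)) (hind : iIndepFun Y P) {p : ℝ}
    (hp0 : 0 < p) (hp : ∀ z, P.real {ω | Y z ω = True} = p) :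
    ∀ᵐ ω ∂P, ∀ a, ∃ n, IsSpanned Finset.univ {z | Y z ω} (axisCube a Finset.univ n) := by
  rw [ae_all_iff]
  intro a
  -- Decay to zero suffices: failure at all sizes is contained in failure at each single size.
  obtain ⟨C, hC⟩ := spanningFailureDecays hY hind hp0 hp Finset.univ 1
  have hlim : Tendsto (fun n : ℕ => C / ((n : ℝ) + 1)) atTop (𝓝 0) :=
    tendsto_const_nhds.div_atTop
      (tendsto_atTop_add_const_right _ _ tendsto_natCast_atTop_atTop)
  rw [ae_iff, ← measureReal_eq_zero_iff]
  refine le_antisymm (ge_of_tendsto' hlim fun n => ?_) measureReal_nonneg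
  rw [le_div_iff₀ (by positivity)]
  refine le_trans (mul_le_mul_of_nonneg_right ?_ (by positivity)) (by simpa using hC n a)
  exact measureReal_mono fun ω hω h => hω ⟨n, h⟩

end RandomBootstrap

/-! ### Occupied cells and the conclusion -/

theorem ae_exists_isSpanned_slabCell {d K : ℕ} {θ : ℝ} (hθ0 : 0 < θ) {Ω : Type*}
    [MeasurableSpace Ω] {P : Measure Ω} [IsProbabilityMeasure P] {η : SlabVertex d K → Ω → ℤˣ}
    (hη_meas : ∀ x, Measurable (η x)) (hη_law : ∀ x, P {ω | η x ω = 1} = ENNReal.ofReal θ)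
    (hη_indep : iIndepFun η P) :
    ∀ᵐ ω ∂P, ∀ a, ∃ n, IsSpanned Finset.univ {z | ∀ x ∈ slabCell d K z, η x ω = 1}
      (axisCube a Finset.univ n) := by
  have hdep : ∀ z, DependsOn (fun f : SlabVertex d K → ℤˣ => ∀ x ∈ slabCell d K z, f x = 1)
      (↑(slabCell d K z) : Set (SlabVertex d K)) := fun z f g hfg =>
    propext (forall₂_congr fun x hx => by rw [hfg x hx])
  have hcard : ∀ z, (slabCell d K z).card = (slabCell d K 0).card := fun z => by
    rw [slabCell, slabCell, Finset.card_product, Finset.card_product, Pi.card_Icc, Pi.card_Icc]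
    congr 1
    refine Finset.prod_congr rfl fun i _ => ?_
    rw [Int.card_Icc, Int.card_Icc, Pi.zero_apply]
    omega
  have hlaw : ∀ x, P.real {ω | η x ω = 1} = θ := fun x => by
    rw [Measure.real, hη_law, ENNReal.toReal_ofReal hθ0.le]
  refine ae_exists_isSpanned (Y := fun z ω => ∀ x ∈ slabCell d K z, η x ω = 1)
    (p := θ ^ (slabCell d K 0).card) (fun z => ?_) ?_ (pow_pos hθ0 _) fun z => ?_
  · exact measurableSet_setOfPred.1 ((hdep z).measurableSet_setOf hη_meas)
  · exact iIndepFun_of_dependsOn hdep (fun z z' h => slabCell_disjoint h) hη_meas hη_indep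
  · simp only [eq_iff_iff, iff_true]
    rw [measureReal_forall_eq hη_indep _ _ hlaw, hcard]

theorem theorem3p4 (d K : ℕ) (hd : 2 ≤ d) (hK : 1 ≤ K) (θ : ℝ) (hθ0 : 0 < θ) (hθ1 : θ ≤ 1)
    {Ω : Type*} [MeasurableSpace Ω] (P : Measure Ω) [IsProbabilityMeasure P]
    -- i.i.d. initial spins, equal to `+1` with probability `θ`
    (η : SlabVertex d K → Ω → ℤˣ)
    (hη_meas : ∀ x, Measurable (η x))
    (hη_law : ∀ x, P {ω | η x ω = 1} = ENNReal.ofReal θ)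
    (hη_indep : iIndepFun η P)
    -- independent Poisson clocks of rate `1`
    (N : SlabVertex d K → ℝ≥0 → Ω → ℕ)
    (hN_poisson : ∀ x, IsPoissonProcess (N x) 1 P)
    (hN_indep : iIndepFun (fun x ω t => N x t ω) P)
    -- independent fair tie-breaking coins
    (c : SlabVertex d K → ℕ → Ω → ℤˣ)
    (hc_meas : ∀ x n, Measurable (c x n))
    (hc_law : ∀ x n, P {ω | c x n ω = 1} = 1 / 2)
    (hc_indep : iIndepFun (fun p : SlabVertex d K × ℕ => c p.1 p.2) P)
    -- initial spins, clocks and coins are independent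
    (hNc : IndepFun (fun ω x t => N x t ω) (fun ω x n => c x n ω) P)
    (hηNc : IndepFun (fun ω x => η x ω)
      (fun ω => ((fun x t => N x t ω), (fun x n => c x n ω))) P) :
    ∀ᵐ ω ∂P,
      (∃ σ : ℝ≥0 → SlabVertex d K → ℤˣ,
        IsTrajectory (slabGraph d K) (slabBottom d K)
          (fun x => η x ω) (fun x t => N x t ω) (fun x n => c x n ω) σ) ∧
      ∀ σ : ℝ≥0 → SlabVertex d K → ℤˣ,
        IsTrajectory (slabGraph d K) (slabBottom d K)
          (fun x => η x ω) (fun x t => N x t ω) (fun x n => c x n ω) σ →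
        ∀ x, ∃ T : ℝ≥0, ∀ t, T ≤ t → σ t x = 1 := by
  have hzero : ∀ᵐ ω ∂P, ∀ x, N x 0 ω = 0 := ae_all_iff.2 fun x => (hN_poisson x).zero
  have hmono : ∀ᵐ ω ∂P, ∀ x, Monotone fun t => N x t ω :=
    ae_all_iff.2 fun x => (hN_poisson x).mono
  have hcts : ∀ᵐ ω ∂P, ∀ x, ∀ t, ContinuousWithinAt (fun s => N x s ω) (Set.Ici t) t :=
    ae_all_iff.2 fun x => (hN_poisson x).rightCts
  have hwin : ∀ᵐ ω ∂P, ∀ U : Finset (SlabVertex d K), ∃ r,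
      IsGoodWindow U (fun x t => N x t ω) (fun x n => c x n ω) r :=
    ae_all_iff.2 fun U => ae_exists_isGoodWindow hN_poisson hN_indep hc_meas hc_law hc_indep hNc U
  filter_upwards [hzero, hmono, hcts, hwin,
    ae_exists_isSpanned_slabCell hθ0 hη_meas hη_law hη_indep] with ω h0 h1 h2 h3 h4
  have hpath : ∀ x, IsCountingPath fun t => N x t ω := fun x => ⟨h0 x, h1 x, h2 x⟩
  refine ⟨exists_isTrajectory hpath, fun σ hσ x => ?_⟩
  by_cases hx : x ∈ slabBottom d K
  · exact ⟨0, fun t _ => hσ.frozen x hx t⟩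
  classical
  -- The spanned cube of cells starts at the cell containing `x`; `Z'` collects its initially plus
  -- cells, the seed for the good window.
  obtain ⟨n, hn⟩ := h4 fun i => x.1 i / 2
  set Z := axisCubeFinset (fun i => x.1 i / 2) Finset.univ n with hZ
  set Z' := Z.filter fun z => ∀ y ∈ slabCell d K z, η y ω = 1 with hZ'
  rw [← coe_axisCubeFinset] at hn
  obtain ⟨r, hr⟩ := h3 (Z.biUnion (slabCell d K))
  refine ⟨_, fun t ht => hσ.eq_one_of_isGoodWindow hpath (A := Z'.biUnion (slabCell d K))
    (U := Z.biUnion (slabCell d K)) ?_ ?_ ?_ (outDegree_lt_inDegree_slabCell Z')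
    (outDegree_lt_inDegree_slabCell Z) ?_ hr ht x ?_⟩
  · rintro ⟨u, k⟩ hy hyF
    obtain ⟨z, -, hz⟩ := Finset.mem_biUnion.1 hy
    exact (mem_slabCell.1 hz).2 hyF
  · intro y hy
    obtain ⟨z, hz, hyz⟩ := Finset.mem_biUnion.1 hy
    exact (Finset.mem_filter.1 hz).2 y hyz
  · exact Finset.biUnion_subset_biUnion_of_subset_left _ (Finset.filter_subset _ _)
  · intro C hC hmaj
    exact subset_of_majorityClosed hn
      (fun z hz => Finset.mem_coe.2 (Finset.mem_filter.2 ⟨hz.2, hz.1⟩)) hC hmaj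
  · refine Finset.mem_biUnion.2 ⟨_, ?_, mem_slabCell.2 ⟨fun i => rfl, hx⟩⟩
    rw [hZ, ← Finset.mem_coe, coe_axisCubeFinset]
    exact self_mem_axisCube _ _ _
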